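/- Let $M\in\mathbb{R}^{m\times n}$ be a nonzero matrix with spectral norm $\|M\|$, let $f:\mathbb{R}^n\to\,]-\infty,+\infty]$ be proper, lower semicontinuous and $\alpha$-convex, and let $g:\mathbb{R}^m\to\,]-\infty,+\infty]$ be proper, lower semicontinuous and $\beta$-convex, where $\alpha,\beta\in\mathbb{R}$ satisfy $\alpha\ge 0$ and $\alpha+\beta\|M\|^2\ge 0$. (A function $h$ is $\alpha$-convex if $h-\frac{\alpha}{2}\|\cdot\|^2$ is convex.) Consider the problem $$(\mathcal P)\qquad \min\ f(x)+g(z)\quad\text{s.t. } Mx=z,\ x\in\mathbb{R}^n,\ z\in\mathbb{R}^m,$$ (a solution is a feasible point that minimizes the objective with finite value) and its Lagrangian $L_0(x,z,y)=f(x)+g(z)+\langle y,Mx-z\rangle$. A point $(x^\star,z^\star,y^\star)$ is a critical point of $L_0$ if $-M^Ty^\star\in\partial f(x^\star)$, $y^\star\in\widehat\partial g(z^\star)$ and $Mx^\star=z^\star$, where $\partial$ is the convex subdifferential and $\widehat\partial$ the Fréchet subdifferential (both empty outside the effective domain); it is a saddle point if $L_0(x^\star,z^\star,y)\le L_0(x^\star,z^\star,y^\star)\le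 L_0(x,z,y^\star)$ for all $(x,z,y)$. Suppose that one of the following conditions holds: (A.1) $L_0$ has a critical point; (A.2) $L_0$ has a saddle point; (A.3) $(\mathcal P)$ has a solution and $0\in\mathrm{ri}(\mathrm{dom}\, g-M(\mathrm{dom}\, f))$; and that one of the following conditions holds: (B.1) $0\in\mathrm{ri}(\mathrm{dom}\, f^*-\mathrm{ran}\, M^T)$, where $f^*(u)=\sup_x\{\langle u,x\rangle-f(x)\}$; (B.2) $\mathrm{ri}(\mathrm{ran}\,\partial f)\cap\mathrm{ran}\, M^T\ne\varnothing$; (B.3) $(\mathrm{rec} f)(x)>0$ for all $x\in\ker M\setminus\{x:\,-(\mathrm{rec} f)(-x)=(\mathrm{rec} f)(x)=0\}$, where $(\mathrm{rec} f)(y)=\sup_{x\in\mathrm{dom} f}\{f(x+y)-f(x)\}$; (B.4) $f$ is coercive, i.e. $f(x)\to+\infty$ as $\|x\|\to\infty$; (B.5) $\alpha>0$; (B.6) $M^TM$ is invertible. Let $\delta>\max\{0,-2\beta\}$, let $\Delta_\delta=\frac{1}{\|M\|}\sqrt{2(\alpha+\beta\|M\|^2)(\delta+2\beta)}$, and let $\gamma=\delta+2\beta$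 if $\alpha+\beta\|M\|^2=0$, and $\gamma\in\,]\max\{0,\delta+2\beta-\Delta_\delta\},\,\delta+2\beta+\Delta_\delta[$ if $\alpha+\beta\|M\|^2>0$. Consider the adaptive ADMM (aADMM) $$x^{k+1}\in\operatorname*{argmin}_{x\in\mathbb{R}^n}\Big\{f(x)+\tfrac{\gamma}{2}\big\|Mx-z^k+\tfrac{y^k}{\gamma}\big\|^2\Big\},$$ $$z^{k+1}\in\operatorname*{argmin}_{z\in\mathbb{R}^m}\Big\{g(z)+\tfrac{\delta}{2}\big\|Mx^{k+1}-z+\tfrac{y^k}{\delta}\big\|^2\Big\},$$ $$y^{k+1}=y^k+\delta(Mx^{k+1}-z^{k+1}).$$ Then from every initial point $(x^0,z^0,y^0)\in\mathbb{R}^n\times\mathbb{R}^m\times\mathbb{R}^m$ the aADMM generates a sequence (the minimizers exist), and for every sequence $(x^k,z^k,y^k)_{k\ge0}$ that it generates (with any choice of minimizers) there is a critical point $(x^\star,z^\star,y^\star)$ of $L_0$ with $$Mx^k\to Mx^\star,\qquad z^k\to z^\star,\qquad y^k\to y^\star ,$$ and $(x^\star,z^\star)$ is a solution of $(\mathcal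 P)$. If, in particular, (B.5) or (B.6) holds, then also $x^k\to x^\star$. -/

import Mathlib

open Filter Topology Set
open scoped Pointwise Matrix Matrix.Norms.L2Operator

namespace AADMM

/-- The Euclidean space `ℝⁿ`. -/
abbrev Euc (n : ℕ) : Type := EuclideanSpace ℝ (Fin n)

/-- A matrix as the linear map `x ↦ M x` between Euclidean spaces. -/
noncomputable abbrev mulE {m n : ℕ} (M : Matrix (Fin m) (Fin n) ℝ) : Euc n →ₗ[ℝ] Euc m :=
  Matrix.toEuclideanLin M

section Functions

variable {n : ℕ}

/-- The effective domain. -/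
def effDom (f : Euc n → EReal) : Set (Euc n) := {x | f x < ⊤}

/-- `f` takes values in `]-∞, +∞]` and its effective domain is nonempty. -/
def Proper (f : Euc n → EReal) : Prop := (∀ x, f x ≠ ⊥) ∧ (effDom f).Nonempty

/-- `f` is `α`-convex, i.e. `f - (α/2)‖·‖²` is convex. -/
def AlphaConvex (α : ℝ) (f : Euc n → EReal) : Prop :=
  ∀ x y : Euc n, ∀ t ∈ Icc (0 : ℝ) 1,
    f ((1 - t) • x + t • y) ≤
      ((1 - t : ℝ) : EReal) * f x + (t : EReal) * f y
        - ((α / 2 * t * (1 - t) * ‖x - y‖ ^ 2 : ℝ) : EReal)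

/-- `f(x) → +∞` as `‖x‖ → ∞`. -/
def Coercive (f : Euc n → EReal) : Prop :=
  Tendsto f (comap (fun x : Euc n => ‖x‖) atTop) (𝓝 ⊤)

/-- The convex subdifferential (empty outside the effective domain). -/
def subdiff (f : Euc n → EReal) (x : Euc n) : Set (Euc n) :=
  {u | x ∈ effDom f ∧ ∀ y, ((inner ℝ (y - x) u : ℝ) : EReal) + f x ≤ f y}

/-- The Fréchet subdifferential (empty outside the effective domain). -/
noncomputable def frechetSubdiff (f : Euc n → EReal) (x : Euc n) : Set (Euc n) :=
  {u | x ∈ effDom f ∧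
    0 ≤ liminf (fun y => (f y - f x - ((inner ℝ u (y - x) : ℝ) : EReal)) / ((‖y - x‖ : ℝ) : EReal))
      (𝓝[≠] x)}

/-- The range `⋃ₓ ∂f(x)` of the convex subdifferential. -/
def ranSubdiff (f : Euc n → EReal) : Set (Euc n) := ⋃ x, subdiff f x

/-- The recession function `y ↦ sup_{x ∈ dom f} (f (x + y) - f x)`. -/
noncomputable def recFun (f : Euc n → EReal) (y : Euc n) : EReal :=
  ⨆ x ∈ effDom f, (f (x + y) - f x)

/-- The Fenchel conjugate. -/
noncomputable def conj (f : Euc n → EReal) (u : Euc n) : EReal :=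
  ⨆ x, (((inner ℝ u x : ℝ) : EReal) - f x)

/-- The set of global minimizers. -/
def argmin (F : Euc n → EReal) : Set (Euc n) := {x | ∀ x', F x ≤ F x'}

end Functions

section Problem

variable {m n : ℕ} (M : Matrix (Fin m) (Fin n) ℝ) (f : Euc n → EReal) (g : Euc m → EReal)

/-- `(x, z)` solves: minimize `f x + g z` subject to `M x = z`. The optimal value is required to
be finite, so that an infeasible problem has no solution. -/
def IsSolution (x : Euc n) (z : Euc m) : Prop :=
  mulE M x = z ∧ f x + g z < ⊤ ∧
    ∀ (x' : Euc n) (z' : Euc m), mulE M x' = z' → f x + g z ≤ f x' + g z'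

/-- The (unaugmented) Lagrangian `L₀ (x, z, y) = f x + g z + ⟨y, M x - z⟩`. -/
noncomputable def lagrangian (x : Euc n) (z y : Euc m) : EReal :=
  f x + g z + ((inner ℝ y (mulE M x - z) : ℝ) : EReal)

/-- Critical points of the Lagrangian. -/
def IsCritical (x : Euc n) (z y : Euc m) : Prop :=
  -(mulE Mᵀ y) ∈ subdiff f x ∧ y ∈ frechetSubdiff g z ∧ mulE M x - z = 0

/-- Saddle points of the Lagrangian. -/
def IsSaddle (x : Euc n) (z y : Euc m) : Prop :=
  ∀ (x' : Euc n) (z' y' : Euc m),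
    lagrangian M f g x z y' ≤ lagrangian M f g x z y ∧
      lagrangian M f g x z y ≤ lagrangian M f g x' z' y

/-- The sequences `x, z, y` are generated by the adaptive ADMM with parameters `γ, δ`. A minimizer
in the `x`-step need not be unique, and any choice of minimizers is allowed. The terms of the
augmented Lagrangian that are constant in the variable being minimized are left out, so that the
steps are meaningful also when `g (z 0) = +∞`. -/
def IsGenerated (γ δ : ℝ) (x : ℕ → Euc n) (z y : ℕ → Euc m) : Prop :=
  ∀ k : ℕ,
    x (k + 1) ∈ argmin (fun x' : Euc n =>
      f x' + ((γ / 2 * ‖mulE M x' - z k + γ⁻¹ • y k‖ ^ 2 : ℝ) : EReal)) ∧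
    z (k + 1) ∈ argmin (fun z' : Euc m =>
      g z' + ((δ / 2 * ‖mulE M (x (k + 1)) - z' + δ⁻¹ • y k‖ ^ 2 : ℝ) : EReal)) ∧
    y (k + 1) = y k + δ • (mulE M (x (k + 1)) - z (k + 1))

end Problem

/-- `Δ_δ = ‖M‖⁻¹ √(2 (α + β‖M‖²) (δ + 2β))`, with `‖M‖` the spectral norm. -/
noncomputable def paramRadius {m n : ℕ} (M : Matrix (Fin m) (Fin n) ℝ) (α β δ : ℝ) : ℝ :=
  1 / ‖M‖ * √(2 * (α + β * ‖M‖ ^ 2) * (δ + 2 * β))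

end AADMM

/-!
The proof follows one scalar quantity along the iterates. With `s k = y k + δ • z k` the algorithm
updates `s (k + 1) = s k + δ • (M x (k + 1) - z k)`, and the optimality conditions of the two
minimization steps say that `-Mᵀ (y k + γ • (M x (k + 1) - z k))` is a subgradient of `f` at `x (k
+ 1)` and that `y k` is one of `g` at `z k`. All subgradients are used in the form
`StrongSubgradient`, in which the curvatures `α` and `β` are kept: for an `α`-convex function
every local first-order lower bound is a global one with curvature `α`, so that both the convex
subdifferential of `f` and the Fréchet subdifferential of `g` have this form. Monotonicity against
a critical point `(x, z, y)` then shows that `‖s k - (y + δ • z)‖ ^ 2` decreases at least by `δ`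
times a quadratic form in `z k - z` and `M x (k + 1) - z` (`descent_step`). For the admissible
values of `γ` this form dominates a positive multiple of `‖z k - M x (k + 1)‖ ^ 2`
(`exists_mul_sq_le`). Hence the gap `z k - M x (k + 1)` vanishes, the sequence `s k` is bounded,
so are `z k` and `y k`, and any cluster point that can be completed to a critical point is the
limit (`tendsto_of_descent`).

The completion needs care, because `x k` itself may be unbounded. Each of the six conditions on
`f` and `M` implies that a direction of recession of `f` in the kernel of `M` is a direction of
constancy (`KerRecessionConstant`). Modulo these directions, a bound on `f x` and on `M x` bounds
`x` (`isBounded_orthogonal_sublevel`). This gives both the existence of minimizers in the first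
step and, through lower semicontinuity, the missing component of the critical point
(`exists_limit_strongSubgradient`). The relative interior conditions on `dom f* - ran Mᵀ` and `ran
∂f` force all subgradients of `f` to be orthogonal to such a direction, and a function with this
property is constant along it, which is seen from its proximal points
(`sub_le_of_inner_subdiff_eq_zero`).

A critical point exists in all three cases: a saddle point is critical, and for a solution with
the qualification condition the multiplier comes from `exists_multiplier`, applied after the
quadratic `β / 2 ‖·‖ ^ 2` has been moved from `g` to `f` to make both functions convex.
-/

namespace AADMM

/-! ### Extended-real-valued functions through their real values -/

section Basic

variable {n : ℕ} {f : Euc n → EReal}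

lemma Proper.coe_toReal (hf : Proper f) {x : Euc n} (hx : x ∈ effDom f) :
    (((f x).toReal : ℝ) : EReal) = f x :=
  EReal.coe_toReal (ne_of_lt hx) (hf.1 x)

lemma mem_effDom_of_le_coe {x : Euc n} {c : ℝ} (h : f x ≤ c) : x ∈ effDom f :=
  lt_of_le_of_lt h (EReal.coe_lt_top c)

lemma Proper.le_coe_iff (hf : Proper f) {x : Euc n} {c : ℝ} :
    f x ≤ c ↔ x ∈ effDom f ∧ (f x).toReal ≤ c := by
  constructor
  · intro h
    have hx := mem_effDom_of_le_coe h
    rw [← hf.coe_toReal hx] at h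
    exact ⟨hx, EReal.coe_le_coe_iff.1 h⟩
  · rintro ⟨hx, h⟩
    rw [← hf.coe_toReal hx]
    exact EReal.coe_le_coe_iff.2 h

lemma Proper.coe_le_iff (hf : Proper f) {x : Euc n} {c : ℝ} :
    (c : EReal) ≤ f x ↔ (x ∈ effDom f → c ≤ (f x).toReal) := by
  constructor
  · intro h hx
    rw [← hf.coe_toReal hx] at h
    exact EReal.coe_le_coe_iff.1 h
  · intro h
    by_cases hx : x ∈ effDom f
    · rw [← hf.coe_toReal hx]
      exact EReal.coe_le_coe_iff.2 (h hx)
    · have : f x = ⊤ := by simpa [effDom] using hx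
      rw [this]
      exact le_top

lemma Proper.le_iff (hf : Proper f) {x y : Euc n} (hy : y ∈ effDom f) :
    f x ≤ f y ↔ x ∈ effDom f ∧ (f x).toReal ≤ (f y).toReal := by
  conv_lhs => rw [← hf.coe_toReal hy]
  exact hf.le_coe_iff

lemma Proper.add_coe_le_iff (hf : Proper f) {q : Euc n → ℝ} {x y : Euc n} (hy : y ∈ effDom f) :
    f x + ((q x : ℝ) : EReal) ≤ f y + ((q y : ℝ) : EReal) ↔
      x ∈ effDom f ∧ (f x).toReal + q x ≤ (f y).toReal + q y := by
  rw [← hf.coe_toReal hy, ← EReal.coe_add, ← EReal.le_sub_iff_add_le (by simp) (by simp),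
      ← EReal.coe_sub, hf.le_coe_iff, EReal.toReal_coe, le_sub_iff_add_le]

/-- The closedness of the epigraph of a lower semicontinuous function along a filter. -/
lemma le_of_tendsto_of_lsc (hlsc : LowerSemicontinuous f) {ι : Type*} {l : Filter ι} [l.NeBot]
    {u : ι → Euc n} {x : Euc n} {c : ι → ℝ} {c₀ : ℝ} (hu : Tendsto u l (𝓝 x))
    (hc : Tendsto c l (𝓝 c₀)) (h : ∀ᶠ i in l, f (u i) ≤ c i) : f x ≤ c₀ := by
  by_contra! hlt
  obtain ⟨r, hr1, hr2⟩ := EReal.lt_iff_exists_real_btwn.1 hlt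
  have h1 := hu.eventually (hlsc x r hr2)
  have h2 := hc.eventually (gt_mem_nhds (EReal.coe_lt_coe_iff.1 hr1))
  obtain ⟨i, hi1, hi2, hi3⟩ := (h1.and (h2.and h)).exists
  exact absurd (lt_of_lt_of_le hi1 hi3) (not_lt.2 (EReal.coe_le_coe_iff.2 hi2.le))

/-- The defining inequality of `α`-convexity between real numbers. -/
lemma AlphaConvex.toReal_le {α : ℝ} (hc : AlphaConvex α f) (hf : Proper f) {x y : Euc n}
    (hx : x ∈ effDom f) (hy : y ∈ effDom f) {t : ℝ} (h0 : 0 ≤ t) (h1 : t ≤ 1) :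
    (1 - t) • x + t • y ∈ effDom f ∧
      (f ((1 - t) • x + t • y)).toReal ≤
        (1 - t) * (f x).toReal + t * (f y).toReal - α / 2 * t * (1 - t) * ‖x - y‖ ^ 2 := by
  have h := hc x y t ⟨h0, h1⟩
  rw [← hf.coe_toReal hx, ← hf.coe_toReal hy, ← EReal.coe_mul, ← EReal.coe_mul, ← EReal.coe_add,
    ← EReal.coe_sub] at h
  exact hf.le_coe_iff.1 h

lemma AlphaConvex.mono {α α' : ℝ} (hc : AlphaConvex α f) (h : α' ≤ α) : AlphaConvex α' f := by
  intro x y t ht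
  refine (hc x y t ht).trans (EReal.sub_le_sub le_rfl (EReal.coe_le_coe_iff.2 ?_))
  have : 0 ≤ t * (1 - t) * ‖x - y‖ ^ 2 :=
    mul_nonneg (mul_nonneg ht.1 (sub_nonneg.2 ht.2)) (sq_nonneg _)
  nlinarith

end Basic

/-! ### Strong subgradients -/

section Subgradients

variable {n : ℕ} {f : Euc n → EReal} {α : ℝ}

/-- `u` is a subgradient of `f` at `x` with the modulus `α`: on the effective domain, `f` lies
above the quadratic function with value `f x`, slope `u` at `x` and curvature `α`. The inequality
is between real numbers; outside the domain, where `f` is `+∞`, it would be trivial. -/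
def StrongSubgradient (α : ℝ) (f : Euc n → EReal) (x u : Euc n) : Prop :=
  x ∈ effDom f ∧ ∀ y ∈ effDom f,
    (f x).toReal + inner ℝ u (y - x) + α / 2 * ‖y - x‖ ^ 2 ≤ (f y).toReal

/-- For an `α`-convex function a local first-order lower bound is a global one with the
modulus `α`. -/
lemma strongSubgradient_of_eventually (hc : AlphaConvex α f) (hf : Proper f) {x u : Euc n}
    (hx : x ∈ effDom f)
    (h : ∀ ε > 0, ∀ᶠ y in 𝓝 x, y ∈ effDom f →
      (f x).toReal + inner ℝ u (y - x) - ε * ‖y - x‖ ≤ (f y).toReal) :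
    StrongSubgradient α f x u := by
  refine ⟨hx, fun y hy => ?_⟩
  -- the local bound on the segment from `x` to `y`, divided by the parameter `t → 0⁺`
  have key : ∀ ε > 0, inner ℝ u (y - x) - ε * ‖y - x‖ + α / 2 * ‖y - x‖ ^ 2 ≤
      (f y).toReal - (f x).toReal := by
    intro ε hε
    have hlim : Tendsto (fun t : ℝ => (1 - t) • x + t • y) (𝓝[>] 0) (𝓝 x) := by
      have : Continuous (fun t : ℝ => (1 - t) • x + t • y) := by fun_prop
      simpa using (this.tendsto 0).mono_left nhdsWithin_le_nhds
    have hlim2 : Tendsto (fun t : ℝ => inner ℝ u (y - x) - ε * ‖y - x‖ +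
        α / 2 * (1 - t) * ‖y - x‖ ^ 2) (𝓝[>] 0)
        (𝓝 (inner ℝ u (y - x) - ε * ‖y - x‖ + α / 2 * ‖y - x‖ ^ 2)) := by
      have : Continuous (fun t : ℝ => inner ℝ u (y - x) - ε * ‖y - x‖ +
        α / 2 * (1 - t) * ‖y - x‖ ^ 2) := by fun_prop
      simpa using (this.tendsto 0).mono_left nhdsWithin_le_nhds
    refine le_of_tendsto hlim2 ?_
    filter_upwards [hlim.eventually (h ε hε), Ioo_mem_nhdsGT (zero_lt_one' ℝ)] with t ht ht1
    obtain ⟨hmem, hle⟩ := hc.toReal_le hf hx hy ht1.1.le ht1.2.le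
    have h2 := (ht hmem).trans hle
    have e : (1 - t) • x + t • y - x = t • (y - x) := by module
    rw [e, inner_smul_right, norm_smul, Real.norm_of_nonneg ht1.1.le, norm_sub_rev x y] at h2
    refine le_of_mul_le_mul_left ?_ ht1.1
    linarith
  have hlim : Tendsto (fun ε : ℝ => inner ℝ u (y - x) - ε * ‖y - x‖ + α / 2 * ‖y - x‖ ^ 2)
      (𝓝[>] 0) (𝓝 (inner ℝ u (y - x) + α / 2 * ‖y - x‖ ^ 2)) := by
    have : Continuous (fun ε : ℝ => inner ℝ u (y - x) - ε * ‖y - x‖ + α / 2 * ‖y - x‖ ^ 2) := by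
      fun_prop
    simpa using (this.tendsto 0).mono_left nhdsWithin_le_nhds
  have := le_of_tendsto hlim (eventually_nhdsWithin_of_forall key)
  linarith

lemma strongSubgradient_of_quadratic (hc : AlphaConvex α f) (hf : Proper f) {x u : Euc n}
    (hx : x ∈ effDom f) (K : ℝ)
    (h : ∀ y ∈ effDom f, (f x).toReal + inner ℝ u (y - x) - K * ‖y - x‖ ^ 2 ≤ (f y).toReal) :
    StrongSubgradient α f x u := by
  refine strongSubgradient_of_eventually hc hf hx fun ε hε => ?_
  have hlim : Tendsto (fun y : Euc n => K * ‖y - x‖) (𝓝 x) (𝓝 0) := by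
    have : Continuous (fun y : Euc n => K * ‖y - x‖) := by fun_prop
    simpa using this.tendsto x
  filter_upwards [hlim.eventually (gt_mem_nhds hε)] with y hy hyd
  have := h y hyd
  nlinarith [norm_nonneg (y - x)]

lemma mem_frechetSubdiff_iff (hc : AlphaConvex α f) (hf : Proper f) {x u : Euc n} :
    u ∈ frechetSubdiff f x ↔ StrongSubgradient α f x u := by
  constructor
  · rintro ⟨hx, h⟩
    refine strongSubgradient_of_eventually hc hf hx fun ε hε => ?_
    have hlt : ((-ε : ℝ) : EReal) < liminf (fun y => (f y - f x -
        ((inner ℝ u (y - x) : ℝ) : EReal)) / ((‖y - x‖ : ℝ) : EReal)) (𝓝[≠] x) :=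
      lt_of_lt_of_le (by exact_mod_cast neg_neg_of_pos hε) h
    have hev := eventually_nhdsWithin_iff.1 (eventually_lt_of_lt_liminf hlt)
    filter_upwards [hev] with y hy hyd
    by_cases hyx : y = x
    · simp [hyx]
    have h1 := hy hyx
    have hpos : 0 < ‖y - x‖ := norm_pos_iff.2 (sub_ne_zero.2 hyx)
    rw [← hf.coe_toReal hx, ← hf.coe_toReal hyd, ← EReal.coe_sub, ← EReal.coe_sub,
      ← EReal.coe_div, EReal.coe_lt_coe_iff, lt_div_iff₀ hpos] at h1
    linarith
  · rintro ⟨hx, h⟩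
    refine ⟨hx, ?_⟩
    refine EReal.ge_of_forall_gt_iff_ge.1 fun c hc0 => ?_
    have hc0 : c < 0 := by exact_mod_cast hc0
    refine le_liminf_of_le (by isBoundedDefault) ?_
    have hlim : Tendsto (fun y : Euc n => α / 2 * ‖y - x‖) (𝓝[≠] x) (𝓝 0) := by
      have : Continuous (fun y : Euc n => α / 2 * ‖y - x‖) := by fun_prop
      simpa using (this.tendsto x).mono_left nhdsWithin_le_nhds
    filter_upwards [hlim.eventually (lt_mem_nhds hc0), self_mem_nhdsWithin] with y hy hyx
    have hpos : 0 < ‖y - x‖ := norm_pos_iff.2 (sub_ne_zero.2 hyx)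
    rw [EReal.le_div_iff_mul_le (by exact_mod_cast hpos) (EReal.coe_ne_top _)]
    by_cases hyd : y ∈ effDom f
    · rw [← hf.coe_toReal hx, ← hf.coe_toReal hyd, ← EReal.coe_sub, ← EReal.coe_sub,
        ← EReal.coe_mul, EReal.coe_le_coe_iff]
      have := h y hyd
      nlinarith
    · have : f y = ⊤ := by simpa [effDom] using hyd
      rw [this, ← hf.coe_toReal hx, EReal.top_sub_coe, EReal.top_sub_coe]
      exact le_top

lemma mem_subdiff_iff_zero (hf : Proper f) {x u : Euc n} :
    u ∈ subdiff f x ↔ StrongSubgradient 0 f x u := by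
  refine and_congr_right fun hx => forall_congr' fun y => ?_
  rw [← hf.coe_toReal hx, ← EReal.coe_add, hf.coe_le_iff, real_inner_comm, EReal.toReal_coe]
  simp [add_comm]

lemma mem_subdiff_iff (hα : 0 ≤ α) (hc : AlphaConvex α f) (hf : Proper f) {x u : Euc n} :
    u ∈ subdiff f x ↔ StrongSubgradient α f x u := by
  rw [mem_subdiff_iff_zero hf]
  constructor
  · rintro ⟨hx, h⟩
    refine strongSubgradient_of_quadratic hc hf hx 0 fun y hy => ?_
    have := h y hy
    linarith
  · rintro ⟨hx, h⟩
    refine ⟨hx, fun y hy => ?_⟩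
    have := h y hy
    have : 0 ≤ α / 2 * ‖y - x‖ ^ 2 := by positivity
    linarith

/-- The first-order optimality condition for the sum of an `α`-convex function and a real-valued
function that has a quadratic upper bound at the minimizer. -/
lemma strongSubgradient_of_mem_argmin (hc : AlphaConvex α f) (hf : Proper f) {q : Euc n → ℝ}
    {x v : Euc n} (hx : x ∈ argmin fun x' => f x' + ((q x' : ℝ) : EReal)) (K : ℝ)
    (hq : ∀ y, q y ≤ q x + inner ℝ v (y - x) + K * ‖y - x‖ ^ 2) :
    StrongSubgradient α f x (-v) := by
  have key : ∀ y ∈ effDom f, x ∈ effDom f ∧ (f x).toReal + q x ≤ (f y).toReal + q y :=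
    fun y hy => (hf.add_coe_le_iff hy).1 (hx y)
  obtain ⟨x₀, hx₀⟩ := hf.2
  refine strongSubgradient_of_quadratic hc hf (key x₀ hx₀).1 K fun y hy => ?_
  have h1 := (key y hy).2
  have h2 := hq y
  rw [inner_neg_left]
  linarith

/-- Strong subgradients of modulus `α` are `α`-strongly monotone. -/
lemma StrongSubgradient.monotone {x u x' u' : Euc n} (h : StrongSubgradient α f x u)
    (h' : StrongSubgradient α f x' u') : α * ‖x - x'‖ ^ 2 ≤ inner ℝ (u - u') (x - x') := by
  have h1 := h.2 x' h'.1
  have h2 := h'.2 x h.1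
  rw [norm_sub_rev x' x, ← neg_sub x x', inner_neg_right] at h1
  rw [inner_sub_left]
  linarith

end Subgradients

/-! ### Existence of minimizers -/

section Existence

variable {n : ℕ} {f : Euc n → EReal} {α : ℝ}

lemma le_of_sq_le_add_mul {κ A B r : ℝ} (hκ : 0 < κ) (h : κ * r ^ 2 ≤ A + B * r) :
    r ≤ 1 + (|A| + |B|) / κ := by
  by_contra! hr
  have h1 : (|A| + |B|) / κ < r - 1 := by linarith
  rw [div_lt_iff₀ hκ] at h1
  have h0 : 0 ≤ (|A| + |B|) / κ := by positivity
  have hr1 : 1 < r := by linarith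
  have h2 := le_abs_self A
  have h3 : B * r ≤ |B| * r := mul_le_mul_of_nonneg_right (le_abs_self B) (by linarith)
  have h4 : |A| * 1 ≤ |A| * r := mul_le_mul_of_nonneg_left hr1.le (abs_nonneg _)
  nlinarith

/-- An `α`-convex function is bounded below by the quadratic function of curvature `α` up to a term
of linear growth: the bound on a ball, which is compact, spreads by convexity. -/
lemma AlphaConvex.exists_lower_bound (hc : AlphaConvex α f) (hf : Proper f)
    (hlsc : LowerSemicontinuous f) {x₀ : Euc n} (hx₀ : x₀ ∈ effDom f) :
    ∃ C, 0 ≤ C ∧ ∀ x ∈ effDom f,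
      α / 2 * ‖x - x₀‖ ^ 2 - C * (1 + ‖x - x₀‖) ≤ (f x).toReal := by
  obtain ⟨a, -, ha⟩ := LowerSemicontinuousOn.exists_isMinOn (s := Metric.closedBall x₀ 1)
    ⟨x₀, by simp⟩ (isCompact_closedBall x₀ 1) (hlsc.lowerSemicontinuousOn _)
  have hmin : ∀ x ∈ effDom f, ‖x - x₀‖ ≤ 1 → (f a).toReal ≤ (f x).toReal := by
    intro x hx hx1
    have h1 : f a ≤ f x := ha (by simpa [dist_eq_norm] using hx1)
    exact ((hf.le_iff hx).1 h1).2
  refine ⟨|(f a).toReal| + |(f x₀).toReal| + |α|, by positivity, fun x hx => ?_⟩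
  set r := ‖x - x₀‖ with hr
  have hr0 : 0 ≤ r := norm_nonneg _
  have h1 := neg_abs_le (f a).toReal
  have h2 := le_abs_self (f x₀).toReal
  have h4 := le_abs_self α
  have h5 := neg_abs_le α
  have h6 := abs_nonneg (f a).toReal
  have h7 := abs_nonneg (f x₀).toReal
  have h8 := abs_nonneg α
  rcases le_total r 1 with hr1 | hr1
  · have := hmin x hx hr1
    have hr2 : r ^ 2 ≤ 1 := by nlinarith
    have : α / 2 * r ^ 2 ≤ |α| := by nlinarith
    nlinarith
  · have hrpos : 0 < r := by linarith
    -- `t = r⁻¹` gives the point of the unit sphere around `x₀` in the direction of `x`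
    obtain ⟨hmem, hle⟩ := hc.toReal_le hf hx₀ hx (t := r⁻¹) (by positivity)
      (inv_le_one_of_one_le₀ hr1)
    have e : (1 - r⁻¹) • x₀ + r⁻¹ • x - x₀ = r⁻¹ • (x - x₀) := by module
    have h9 := (hmin _ hmem (by
      rw [e, norm_smul, norm_inv, Real.norm_of_nonneg hr0, ← hr,
        inv_mul_cancel₀ hrpos.ne'])).trans hle
    rw [norm_sub_rev x₀ x, ← hr] at h9
    have h10 := mul_le_mul_of_nonneg_left h9 hr0
    have e2 : r * ((1 - r⁻¹) * (f x₀).toReal + r⁻¹ * (f x).toReal -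
        α / 2 * r⁻¹ * (1 - r⁻¹) * r ^ 2) =
        (r - 1) * (f x₀).toReal + (f x).toReal - α / 2 * (r ^ 2 - r) := by
      field_simp
    rw [e2] at h10
    have h11 : (r - 1) * (f x₀).toReal ≤ r * |(f x₀).toReal| := by nlinarith
    have h12 : - (r * |(f a).toReal|) ≤ r * (f a).toReal := by nlinarith
    have h13 : α / 2 * r ≤ |α| * r := by nlinarith
    nlinarith

/-- A lower semicontinuous function attains its minimum over a closed set as soon as one of its
sublevel sets there is bounded. -/
lemma exists_forall_le_of_isBounded (hlsc : LowerSemicontinuous f) {S : Set (Euc n)}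
    (hS : IsClosed S) {x₀ : Euc n} (hx₀ : x₀ ∈ S)
    (hb : Bornology.IsBounded {x | x ∈ S ∧ f x ≤ f x₀}) : ∃ x ∈ S, ∀ x' ∈ S, f x ≤ f x' := by
  have hcl : IsClosed {x | x ∈ S ∧ f x ≤ f x₀} := hS.inter (hlsc.isClosed_preimage (f x₀))
  obtain ⟨a, haS, ha⟩ := LowerSemicontinuousOn.exists_isMinOn (s := {x | x ∈ S ∧ f x ≤ f x₀})
    ⟨x₀, hx₀, le_rfl⟩
    (Metric.isCompact_of_isClosed_isBounded hcl hb) (hlsc.lowerSemicontinuousOn _)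
  refine ⟨a, haS.1, fun x' hx' => ?_⟩
  by_cases h : f x' ≤ f x₀
  · exact ha ⟨hx', h⟩
  · exact haS.2.trans (le_of_not_ge h)

lemma lowerSemicontinuous_add_coe (hlsc : LowerSemicontinuous f) {q : Euc n → ℝ}
    (hq : Continuous q) : LowerSemicontinuous fun x => f x + ((q x : ℝ) : EReal) :=
  LowerSemicontinuous.add' hlsc (continuous_coe_real_ereal.comp hq).lowerSemicontinuous fun x =>
    EReal.continuousAt_add (Or.inr (by simp)) (Or.inr (by simp))

/-- A quadratic penalty that outweighs the negative curvature makes the minimum attained. -/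
lemma exists_mem_argmin_add_sq (hc : AlphaConvex α f) (hf : Proper f)
    (hlsc : LowerSemicontinuous f) {ρ : ℝ} (hρ : 0 < ρ) (hρα : 0 < ρ + α) (w : Euc n) :
    ∃ x, x ∈ argmin fun x' => f x' + ((ρ / 2 * ‖x' - w‖ ^ 2 : ℝ) : EReal) := by
  obtain ⟨x₀, hx₀⟩ := hf.2
  obtain ⟨C, hC, hlow⟩ := hc.exists_lower_bound hf hlsc hx₀
  set q : Euc n → ℝ := fun x' => ρ / 2 * ‖x' - w‖ ^ 2 with hq
  have hlsc' : LowerSemicontinuous fun x => f x + ((q x : ℝ) : EReal) :=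
    lowerSemicontinuous_add_coe hlsc (by fun_prop)
  obtain ⟨x, -, hx⟩ := exists_forall_le_of_isBounded hlsc' isClosed_univ (mem_univ x₀) (by
    refine isBounded_iff_forall_norm_le.2 ?_
    refine ⟨‖x₀‖ + (1 + (|(f x₀).toReal + q x₀ + C| + |C + ρ * ‖x₀ - w‖|) / ((ρ + α) / 2)), ?_⟩
    rintro x ⟨-, hx⟩
    obtain ⟨hxd, hle⟩ := (hf.add_coe_le_iff (q := q) hx₀).1 hx
    have h1 := hlow x hxd
    have h2 : ‖x‖ ≤ ‖x₀‖ + ‖x - x₀‖ := by simpa using norm_add_le x₀ (x - x₀)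
    have h3 : ‖x - x₀‖ ≤ ‖x - w‖ + ‖x₀ - w‖ := by
      simpa using norm_sub_le (x - w) (x₀ - w)
    have h4 : ‖x - x₀‖ ^ 2 - 2 * ‖x₀ - w‖ * ‖x - x₀‖ ≤ ‖x - w‖ ^ 2 := by
      have e : x - w = (x - x₀) + (x₀ - w) := by abel
      rw [e, norm_add_sq_real]
      have := neg_le_of_abs_le (abs_real_inner_le_norm (x - x₀) (x₀ - w))
      nlinarith [sq_nonneg ‖x₀ - w‖]
    have h5 : q x = ρ / 2 * ‖x - w‖ ^ 2 := rfl
    have h6 := le_of_sq_le_add_mul (κ := (ρ + α) / 2) (A := (f x₀).toReal + q x₀ + C)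
      (B := C + ρ * ‖x₀ - w‖) (r := ‖x - x₀‖) (by positivity) (by nlinarith)
    linarith)
  exact ⟨x, fun x' => hx x' (mem_univ _)⟩

end Existence

/-! ### Recession directions in the kernel -/

section Recession

variable {m n : ℕ} {M : Matrix (Fin m) (Fin n) ℝ} {f : Euc n → EReal}

/-- Every direction of recession of `f` in the kernel of `M` is a direction of constancy. A direction
of recession is encoded by the steps of length one, `f (x + d) ≤ f x` for all `x`, which is the same
as `recFun f d ≤ 0`; if `-d` has the property too, then `f` is constant along `d`. -/
def KerRecessionConstant (M : Matrix (Fin m) (Fin n) ℝ) (f : Euc n → EReal) : Prop :=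
  ∀ d, mulE M d = 0 → (∀ x, f (x + d) ≤ f x) → ∀ x, f (x - d) ≤ f x

lemma le_add_nsmul {d : Euc n} (h : ∀ x, f (x + d) ≤ f x) (k : ℕ) (x : Euc n) :
    f (x + k • d) ≤ f x := by
  induction k with
  | zero => simp
  | succ k ih =>
    rw [succ_nsmul, ← add_assoc]
    exact (h _).trans ih

lemma AlphaConvex.le_add_smul (hc : AlphaConvex 0 f) (hf : Proper f) {d : Euc n}
    (h : ∀ x, f (x + d) ≤ f x) {t : ℝ} (ht : 0 ≤ t) (x : Euc n) : f (x + t • d) ≤ f x := by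
  have small : ∀ s : ℝ, 0 ≤ s → s ≤ 1 → ∀ x, f (x + s • d) ≤ f x := by
    intro s hs0 hs1 x
    by_cases hx : x ∈ effDom f
    · have hxd := (hf.le_iff hx).1 (h x)
      obtain ⟨h1, h2⟩ := hc.toReal_le hf hx hxd.1 hs0 hs1
      have e : (1 - s) • x + s • (x + d) = x + s • d := by module
      rw [e] at h1 h2
      refine (hf.le_iff hx).2 ⟨h1, ?_⟩
      nlinarith [hxd.2]
    · have : f x = ⊤ := by simpa [effDom] using hx
      rw [this]
      exact le_top
  -- `N` steps of length `t / N ≤ 1`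
  obtain ⟨N, hN⟩ := exists_nat_gt t
  have hN0 : 0 < (N : ℝ) := ht.trans_lt hN
  have := le_add_nsmul (small (t / N) (by positivity) ((div_le_one hN0).2 hN.le)) N x
  rwa [← Nat.cast_smul_eq_nsmul ℝ, smul_smul, mul_div_cancel₀ _ hN0.ne'] at this

/-- The directions in the kernel of `M` along which `f` is constant. -/
def constancySpace (M : Matrix (Fin m) (Fin n) ℝ) (hc : AlphaConvex 0 f) (hf : Proper f) :
    Submodule ℝ (Euc n) where
  carrier := {d | mulE M d = 0 ∧ ∀ x, f (x + d) = f x}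
  zero_mem' := by simp
  add_mem' := by
    rintro a b ⟨ha, ha'⟩ ⟨hb, hb'⟩
    exact ⟨by rw [map_add, ha, hb, add_zero], fun x => by rw [← add_assoc, hb', ha']⟩
  smul_mem' := by
    rintro t d ⟨hd, hd'⟩
    have hneg : ∀ x, f (x + -d) = f x := fun x => by simpa using (hd' (x + -d)).symm
    have key : ∀ t : ℝ, ∀ x, f (x + t • d) ≤ f x := by
      intro t x
      rcases le_total 0 t with ht | ht
      · exact hc.le_add_smul hf (fun x => (hd' x).le) ht x
      · simpa using hc.le_add_smul hf (fun x => (hneg x).le) (neg_nonneg.2 ht) x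
    refine ⟨by rw [map_smul, hd, smul_zero], fun x => le_antisymm (key t x) ?_⟩
    have := key (-t) (x + t • d)
    rwa [neg_smul, add_neg_cancel_right] at this

/-- On the orthogonal complement of the constancy space, a bound on `f` together with a bound of
square-root growth on `M x` confines `x` to a bounded set: a limit direction of an unbounded
sequence would be a direction of recession in the kernel of `M`, hence one of constancy. -/
lemma isBounded_orthogonal_sublevel (hc : AlphaConvex 0 f) (hf : Proper f)
    (hlsc : LowerSemicontinuous f) (hK : KerRecessionConstant M f) (c K : ℝ) :
    Bornology.IsBounded {x | x ∈ (constancySpace M hc hf)ᗮ ∧ f x ≤ c ∧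
      ‖mulE M x‖ ^ 2 ≤ K * (1 + ‖x‖)} := by
  by_contra hb
  rw [isBounded_iff_forall_norm_le] at hb
  push Not at hb
  choose u hu hur using fun k : ℕ => hb (k + 1)
  have hpos : ∀ k, 0 < ‖u k‖ := fun k => lt_of_le_of_lt (by positivity) (hur k)
  obtain ⟨d, -, φ, hφ, hd⟩ := tendsto_subseq_of_bounded (s := Metric.closedBall (0 : Euc n) 1)
    Metric.isBounded_closedBall (x := fun k => ‖u k‖⁻¹ • u k) (fun k => by
      simp [norm_smul, inv_mul_cancel₀ (hpos k).ne'])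
  have hd1 : ‖d‖ = 1 := by
    refine tendsto_nhds_unique hd.norm ?_
    refine tendsto_const_nhds.congr fun k => ?_
    simp [norm_smul, inv_mul_cancel₀ (hpos (φ k)).ne']
  have hinv : Tendsto (fun k => ‖u (φ k)‖⁻¹) atTop (𝓝 0) := by
    refine tendsto_inv_atTop_zero.comp ?_
    refine tendsto_atTop_mono (fun k => ((hur (φ k)).le.trans' ?_)) tendsto_natCast_atTop_atTop
    have : (k : ℝ) ≤ φ k := by exact_mod_cast hφ.id_le k
    linarith
  have hMd : mulE M d = 0 := by
    have hcont : Continuous fun x => ‖mulE M x‖ ^ 2 :=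
      ((mulE M).continuous_of_finiteDimensional.norm).pow 2
    have h1 := (hcont.tendsto d).comp hd
    have h2 : Tendsto (fun k => K * ‖u (φ k)‖⁻¹ ^ 2 + K * ‖u (φ k)‖⁻¹) atTop (𝓝 0) := by
      simpa using ((hinv.pow 2).const_mul K).add (hinv.const_mul K)
    have h3 := le_of_tendsto_of_tendsto' h1 h2 (fun k => by
      have h := (hu (φ k)).2.2
      have hp := hpos (φ k)
      simp only [Function.comp, map_smul, norm_smul, norm_inv, norm_norm, mul_pow]
      calc ‖u (φ k)‖⁻¹ ^ 2 * ‖mulE M (u (φ k))‖ ^ 2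
          ≤ ‖u (φ k)‖⁻¹ ^ 2 * (K * (1 + ‖u (φ k)‖)) := by gcongr
        _ = _ := by field_simp)
    exact norm_eq_zero.1 (by nlinarith [norm_nonneg (mulE M d)])
  -- the points at distance about `1` from `x` on the segments from `x` to `u (φ k)` tend to `x + d`
  have hrec : ∀ x, f (x + d) ≤ f x := by
    intro x
    by_cases hx : x ∈ effDom f
    · rw [← hf.coe_toReal hx]
      refine le_of_tendsto_of_lsc hlsc (l := atTop)
        (u := fun k => (1 - ‖u (φ k)‖⁻¹) • x + ‖u (φ k)‖⁻¹ • u (φ k))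
        (c := fun k => (1 - ‖u (φ k)‖⁻¹) * (f x).toReal + ‖u (φ k)‖⁻¹ * c) ?_ ?_ ?_
      · have := ((tendsto_const_nhds (x := (1 : ℝ))).sub hinv).smul_const x
        simpa using this.add hd
      · have := ((tendsto_const_nhds (x := (1 : ℝ))).sub hinv).mul_const (f x).toReal
        simpa using this.add (hinv.mul_const c)
      · refine Eventually.of_forall fun k => ?_
        obtain ⟨h1, h2⟩ := hf.le_coe_iff.1 (hu (φ k)).2.1
        have hp := hpos (φ k)
        have h1k : (1 : ℝ) ≤ ‖u (φ k)‖ := (hur (φ k)).le.trans' (by simp)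
        obtain ⟨h3, h4⟩ := hc.toReal_le hf hx h1 (inv_nonneg.2 hp.le) (inv_le_one_of_one_le₀ h1k)
        refine hf.le_coe_iff.2 ⟨h3, ?_⟩
        have := mul_le_mul_of_nonneg_left h2 (inv_nonneg.2 hp.le)
        linarith
    · have : f x = ⊤ := by simpa [effDom] using hx
      rw [this]
      exact le_top
  have hdL : d ∈ constancySpace M hc hf :=
    ⟨hMd, fun x => le_antisymm (hrec x) (by simpa using hK d hMd hrec (x + d))⟩
  have hdL' : d ∈ (constancySpace M hc hf)ᗮ := by
    refine (Submodule.isClosed_orthogonal _).mem_of_tendsto hd (Eventually.of_forall fun k => ?_)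
    exact Submodule.smul_mem _ _ (hu (φ k)).1
  have := Submodule.inner_right_of_mem_orthogonal hdL hdL'
  rw [real_inner_self_eq_norm_sq, hd1] at this
  norm_num at this

/-- Projection along the constancy space changes neither `f` nor `M`. -/
lemma exists_mem_orthogonal_constancySpace (hc : AlphaConvex 0 f) (hf : Proper f) (x : Euc n) :
    ∃ x' ∈ (constancySpace M hc hf)ᗮ, f x' = f x ∧ mulE M x' = mulE M x := by
  set L := constancySpace M hc hf
  have h1 : L.starProjection x ∈ L := L.starProjection_apply_mem x
  refine ⟨x - L.starProjection x, Submodule.sub_starProjection_mem_orthogonal x, ?_, ?_⟩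
  · have := h1.2 (x - L.starProjection x)
    rwa [sub_add_cancel, eq_comm] at this
  · rw [map_sub, h1.1, sub_zero]

/-- The first step of the algorithm has a minimizer: over the orthogonal complement of the constancy
space the sublevel sets are bounded, because there the penalty grows at most linearly. -/
lemma KerRecessionConstant.exists_mem_argmin (hK : KerRecessionConstant M f)
    (hc : AlphaConvex 0 f) (hf : Proper f) (hlsc : LowerSemicontinuous f) {γ : ℝ} (hγ : 0 < γ)
    (w : Euc m) :
    ∃ x, x ∈ argmin fun x' => f x' + ((γ / 2 * ‖mulE M x' - w‖ ^ 2 : ℝ) : EReal) := by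
  obtain ⟨x₁, hx₁⟩ := hf.2
  obtain ⟨x₀, hx₀L, hx₀f, -⟩ := exists_mem_orthogonal_constancySpace (M := M) hc hf x₁
  have hx₀ : x₀ ∈ effDom f := by
    simpa [effDom, hx₀f] using hx₁
  obtain ⟨C, hC, hlow⟩ := hc.exists_lower_bound hf hlsc hx₀
  set q : Euc n → ℝ := fun x' => γ / 2 * ‖mulE M x' - w‖ ^ 2 with hq
  have hMc : Continuous (mulE M) := (mulE M).continuous_of_finiteDimensional
  have hlsc' : LowerSemicontinuous fun x => f x + ((q x : ℝ) : EReal) :=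
    lowerSemicontinuous_add_coe hlsc (by fun_prop)
  set c₀ := (f x₀).toReal + q x₀ with hc₀
  set K := 2 * ‖w‖ ^ 2 + 4 / γ * (|c₀| + C * (1 + ‖x₀‖)) with hKdef
  obtain ⟨x, -, hx⟩ := exists_forall_le_of_isBounded hlsc'
    (Submodule.isClosed_orthogonal (constancySpace M hc hf)) hx₀L (by
      refine (isBounded_orthogonal_sublevel hc hf hlsc hK c₀ K).subset ?_
      rintro x ⟨hxL, hx⟩
      obtain ⟨hxd, hle⟩ := (hf.add_coe_le_iff (q := q) hx₀).1 hx
      have hqx : q x = γ / 2 * ‖mulE M x - w‖ ^ 2 := rfl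
      have hq0 : 0 ≤ q x := by positivity
      refine ⟨hxL, hf.le_coe_iff.2 ⟨hxd, by linarith⟩, ?_⟩
      have h1 := hlow x hxd
      have h2 : ‖x - x₀‖ ≤ ‖x‖ + ‖x₀‖ := norm_sub_le _ _
      have h3 : ‖mulE M x‖ ^ 2 ≤ 2 * ‖mulE M x - w‖ ^ 2 + 2 * ‖w‖ ^ 2 := by
        have h := norm_add_le (mulE M x - w) w
        rw [sub_add_cancel] at h
        have h' := pow_le_pow_left₀ (norm_nonneg _) h 2
        nlinarith [sq_nonneg (‖mulE M x - w‖ - ‖w‖)]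
      have h4 : ‖mulE M x - w‖ ^ 2 ≤ 2 / γ * (|c₀| + C * (1 + (‖x‖ + ‖x₀‖))) := by
        rw [div_mul_eq_mul_div, le_div_iff₀ hγ]
        have h5 : C * (1 + ‖x - x₀‖) ≤ C * (1 + (‖x‖ + ‖x₀‖)) := by gcongr
        have h6 := le_abs_self c₀
        nlinarith
      have h7 : |c₀| + C * (1 + (‖x‖ + ‖x₀‖)) ≤ (|c₀| + C * (1 + ‖x₀‖)) * (1 + ‖x‖) := by
        have : 0 ≤ |c₀| * ‖x‖ := by positivity
        have : 0 ≤ C * ‖x₀‖ * ‖x‖ := by positivity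
        nlinarith
      have h8 : 4 / γ * (|c₀| + C * (1 + (‖x‖ + ‖x₀‖))) ≤
          4 / γ * ((|c₀| + C * (1 + ‖x₀‖)) * (1 + ‖x‖)) :=
        mul_le_mul_of_nonneg_left h7 (by positivity)
      have h9 : 0 ≤ ‖w‖ ^ 2 * ‖x‖ := by positivity
      have h10 : 2 * (2 / γ * (|c₀| + C * (1 + (‖x‖ + ‖x₀‖)))) =
        4 / γ * (|c₀| + C * (1 + (‖x‖ + ‖x₀‖))) := by ring
      rw [hKdef]
      nlinarith)
  refine ⟨x, fun x' => ?_⟩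
  obtain ⟨x'', hL, hfx, hMx⟩ := exists_mem_orthogonal_constancySpace (M := M) hc hf x'
  have := hx x'' hL
  simpa only [hq, hfx, hMx] using this

end Recession

/-! ### Relative interiors and Lagrange multipliers -/

section RelativeInterior

variable {V : Type*} [NormedAddCommGroup V] [InnerProductSpace ℝ V]

lemma exists_smul_add_mem_of_mem_intrinsicInterior {S : Set V} {u v : V}
    (hu : u ∈ intrinsicInterior ℝ S) (hv : v ∈ (affineSpan ℝ S).direction) :
    ∃ ε : ℝ, 0 < ε ∧ ε • v + u ∈ S := by
  obtain ⟨y, hy, rfl⟩ := mem_intrinsicInterior.1 hu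
  let c : ℝ → affineSpan ℝ S := fun t =>
    ⟨t • v + y, AffineSubspace.vadd_mem_of_mem_direction (Submodule.smul_mem _ t hv) y.2⟩
  have hc : Continuous c := by
    refine Continuous.subtype_mk ?_ _
    fun_prop
  have hc0 : c 0 = y := Subtype.ext (by simp [c])
  have h1 : ∀ᶠ t in 𝓝 (0 : ℝ), c t ∈ interior (Subtype.val ⁻¹' S) :=
    (hc.tendsto 0).eventually (by rw [hc0]; exact isOpen_interior.mem_nhds hy)
  obtain ⟨ε, hε, hpos⟩ := ((h1.filter_mono nhdsWithin_le_nhds).and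
    (self_mem_nhdsWithin (s := Ioi (0 : ℝ)))).exists
  have hmem : c ε ∈ Subtype.val ⁻¹' S := interior_subset hε
  exact ⟨ε, hpos, hmem⟩

/-- A linear functional that attains its maximum over a set at a relative interior point is
constant on the set. -/
lemma inner_eq_zero_of_mem_intrinsicInterior {S : Set V} {u d : V}
    (hu : u ∈ intrinsicInterior ℝ S) (hud : inner ℝ u d = 0) (hS : ∀ v ∈ S, inner ℝ v d ≤ 0)
    {v : V} (hv : v ∈ S) : inner ℝ v d = 0 := by
  refine le_antisymm (hS v hv) ?_
  obtain ⟨ε, hε, hmem⟩ := exists_smul_add_mem_of_mem_intrinsicInterior hu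
    (AffineSubspace.vsub_mem_direction
      (subset_affineSpan ℝ S (intrinsicInterior_subset hu)) (subset_affineSpan ℝ S hv))
  have := hS _ hmem
  rw [vsub_eq_sub, inner_add_left, inner_smul_left, inner_sub_left, hud] at this
  simp only [conj_trivial] at this
  nlinarith

/-- A convex minimization problem under a linear constraint has a Lagrange multiplier when `0` is in
the relative interior of the set of feasible perturbations. The multiplier is a linear functional
below the directional derivative at `0` of the value function, which is sublinear and, thanks to the
qualification condition, finite on the span of the perturbations. -/
lemma exists_multiplier [FiniteDimensional ℝ V] {X : Type*} [AddCommGroup X] [Module ℝ X]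
    {D : Set X} {φ : X → ℝ} (hφ : ConvexOn ℝ D φ) (A : X →ₗ[ℝ] V) {x₀ : X} (hx₀ : x₀ ∈ D)
    (hAx₀ : A x₀ = 0) (hmin : ∀ x ∈ D, A x = 0 → φ x₀ ≤ φ x)
    (hri : 0 ∈ intrinsicInterior ℝ (A '' D)) :
    ∃ ξ : V, ∀ x ∈ D, φ x₀ + inner ℝ ξ (A x) ≤ φ x := by
  set W : Submodule ℝ V := (affineSpan ℝ (A '' D)).direction with hW
  have hAW : ∀ x ∈ D, A x ∈ W := by
    intro x hx
    have := AffineSubspace.vsub_mem_direction (subset_affineSpan ℝ _ (mem_image_of_mem A hx))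
      (subset_affineSpan ℝ _ (mem_image_of_mem A hx₀))
    rwa [hAx₀, vsub_eq_sub, sub_zero] at this
  -- the difference quotients at `0` of the value function in the direction `w`
  let S : W → Set ℝ := fun w =>
    {s | ∃ t : ℝ, 0 < t ∧ ∃ x ∈ D, A x = t • (w : V) ∧ φ x - φ x₀ = t * s}
  have hne : ∀ w, (S w).Nonempty := by
    intro w
    obtain ⟨t, ht, x, hx, hxt⟩ := exists_smul_add_mem_of_mem_intrinsicInterior hri w.2
    exact ⟨(φ x - φ x₀) / t, t, ht, x, hx, by rw [hxt, add_zero],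
      (mul_div_cancel₀ _ ht.ne').symm⟩
  have hS0 : ∀ s ∈ S 0, 0 ≤ s := by
    rintro s ⟨t, ht, x, hx, hAx, hs⟩
    have := hmin x hx (by simpa using hAx)
    exact (mul_nonneg_iff_of_pos_left ht).1 (by linarith)
  -- combine the two feasible points with weights that make the perturbation a multiple of `w + w'`
  have hSadd : ∀ w w' : W, ∀ s ∈ S w, ∀ s' ∈ S w', ∃ s'' ∈ S (w + w'), s'' ≤ s + s' := by
    rintro w w' s ⟨t, ht, x, hx, hAx, hs⟩ s' ⟨t', ht', x', hx', hAx', hs'⟩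
    have hsum : t' / (t + t') + t / (t + t') = 1 := by field_simp; ring
    have hmem := hφ.1 hx hx' (show 0 ≤ t' / (t + t') by positivity)
      (show 0 ≤ t / (t + t') by positivity) hsum
    have hle := hφ.2 hx hx' (show 0 ≤ t' / (t + t') by positivity)
      (show 0 ≤ t / (t + t') by positivity) hsum
    have htt : 0 < t * t' / (t + t') := by positivity
    refine ⟨_, ⟨t * t' / (t + t'), htt, _, hmem, ?_, (mul_div_cancel₀ _ htt.ne').symm⟩, ?_⟩
    · rw [map_add, map_smul, map_smul, hAx, hAx', smul_smul, smul_smul, Submodule.coe_add,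
        smul_add]
      congr 2 <;> ring
    · rw [div_le_iff₀ htt]
      have h1 : φ x = φ x₀ + t * s := by linarith
      have h2 : φ x' = φ x₀ + t' * s' := by linarith
      rw [h1, h2, smul_eq_mul, smul_eq_mul] at hle
      have h3 : t' / (t + t') * (φ x₀ + t * s) + t / (t + t') * (φ x₀ + t' * s') =
          φ x₀ + (s + s') * (t * t' / (t + t')) := by
        field_simp
        ring
      linarith
  have hbdd : ∀ w, BddBelow (S w) := by
    intro w
    obtain ⟨s', hs'⟩ := hne (-w)
    refine ⟨-s', fun s hs => ?_⟩
    obtain ⟨s'', hs'', hle⟩ := hSadd w (-w) s hs s' hs'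
    rw [add_neg_cancel] at hs''
    linarith [hS0 s'' hs'']
  have hSsmul : ∀ c : ℝ, 0 < c → ∀ w, ∀ s ∈ S w, c * s ∈ S (c • w) := by
    rintro c hc w s ⟨t, ht, x, hx, hAx, hs⟩
    refine ⟨t / c, by positivity, x, hx, ?_, ?_⟩
    · rw [hAx, Submodule.coe_smul, smul_smul, div_mul_cancel₀ _ hc.ne']
    · rw [hs]
      field_simp
  have hhom : ∀ c : ℝ, 0 < c → ∀ w, sInf (S (c • w)) ≤ c * sInf (S w) := by
    intro c hc w
    rw [← div_le_iff₀' hc]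
    refine le_csInf (hne w) fun s hs => ?_
    rw [div_le_iff₀' hc]
    exact csInf_le (hbdd _) (hSsmul c hc w s hs)
  obtain ⟨ℓ, -, hℓ⟩ := exists_extension_of_le_sublinear (⟨⊥, 0⟩ : W →ₗ.[ℝ] ℝ)
    (fun w => sInf (S w)) (by
      intro c hc w
      refine le_antisymm (hhom c hc w) ?_
      have := hhom c⁻¹ (inv_pos.2 hc) (c • w)
      rw [smul_smul, inv_mul_cancel₀ hc.ne', one_smul] at this
      rwa [← le_inv_mul_iff₀ hc]) (by
      intro w w'
      rw [← sub_le_iff_le_add]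
      refine le_csInf (hne w) fun s hs => ?_
      rw [sub_le_comm]
      refine le_csInf (hne w') fun s' hs' => ?_
      obtain ⟨s'', hs'', hle⟩ := hSadd w w' s hs s' hs'
      have := csInf_le (hbdd _) hs''
      linarith) (by
      rintro ⟨w, hw⟩
      rw [Submodule.mem_bot] at hw
      subst hw
      exact le_csInf (hne 0) hS0)
  set ξ : W := (InnerProductSpace.toDual ℝ W).symm (LinearMap.toContinuousLinearMap ℓ) with hξ
  refine ⟨ξ, fun x hx => ?_⟩
  have h1 : inner ℝ ξ ⟨A x, hAW x hx⟩ = ℓ ⟨A x, hAW x hx⟩ := by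
    rw [hξ, InnerProductSpace.toDual_symm_apply]
    rfl
  have h2 : inner ℝ (ξ : V) (A x) = inner ℝ ξ ⟨A x, hAW x hx⟩ := rfl
  have h3 : sInf (S ⟨A x, hAW x hx⟩) ≤ φ x - φ x₀ :=
    csInf_le (hbdd _) ⟨1, one_pos, x, hx, by simp, by simp⟩
  have := hℓ ⟨A x, hAW x hx⟩
  rw [h2, h1]
  linarith

end RelativeInterior

/-! ### Sufficient conditions for constancy along recession directions -/

section Conditions

variable {m n : ℕ} {M : Matrix (Fin m) (Fin n) ℝ} {f : Euc n → EReal}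

lemma inner_mulE_transpose (M : Matrix (Fin m) (Fin n) ℝ) (x : Euc n) (y : Euc m) :
    inner ℝ (mulE Mᵀ y) x = inner ℝ y (mulE M x) := by
  have h : mulE Mᵀ = LinearMap.adjoint (mulE M) := by
    rw [← Matrix.toEuclideanLin_conjTranspose_eq_adjoint,
      Matrix.conjTranspose_eq_transpose_of_trivial]
  rw [h, LinearMap.adjoint_inner_left]

lemma norm_mulE_le (M : Matrix (Fin m) (Fin n) ℝ) (x : Euc n) : ‖mulE M x‖ ≤ ‖M‖ * ‖x‖ :=
  Matrix.l2_opNorm_mulVec M x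

lemma mulE_injective (h : IsUnit (Mᵀ * M)) : Function.Injective (mulE M) := by
  rw [← LinearMap.ker_eq_bot, LinearMap.ker_eq_bot']
  intro x hx
  have h1 : M *ᵥ x.ofLp = 0 := by
    have := congrArg WithLp.ofLp hx
    simpa using this
  have h2 : (Mᵀ * M) *ᵥ x.ofLp = (Mᵀ * M) *ᵥ 0 := by
    rw [← Matrix.mulVec_mulVec, h1, Matrix.mulVec_zero, Matrix.mulVec_zero]
  have := Matrix.mulVec_injective_of_isUnit h h2
  ext i
  simpa using congrFun this i

lemma quadratic_expand (T : Euc n →ₗ[ℝ] Euc m) (ρ : ℝ) (w : Euc m) (x y : Euc n) :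
    ρ / 2 * ‖T y - w‖ ^ 2 = ρ / 2 * ‖T x - w‖ ^ 2 + ρ * inner ℝ (T x - w) (T (y - x)) +
      ρ / 2 * ‖T (y - x)‖ ^ 2 := by
  have e : T y - w = (T x - w) + T (y - x) := by rw [map_sub]; abel
  rw [e, norm_add_sq_real]
  ring

lemma inner_le_zero_of_subdiff (hf : Proper f) {d : Euc n} (hd : ∀ x, f (x + d) ≤ f x) {v : Euc n}
    (hv : v ∈ ranSubdiff f) : inner ℝ v d ≤ 0 := by
  obtain ⟨p, hp⟩ := mem_iUnion.1 hv
  rw [mem_subdiff_iff_zero hf] at hp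
  have h1 := (hf.le_iff hp.1).1 (hd p)
  have h2 := hp.2 _ h1.1
  rw [add_sub_cancel_left] at h2
  linarith [h1.2]

/-- If all subgradients are orthogonal to `d`, then `f` does not increase along `-d`. With `p` the
proximal point of `w = x - d` for the parameter `ρ`, the subgradient inequality reads
`f p + ρ ‖w - p‖ ^ 2 ≤ f x`; as `ρ` grows, `p` tends to `w`. -/
lemma sub_le_of_inner_subdiff_eq_zero (hc : AlphaConvex 0 f) (hf : Proper f)
    (hlsc : LowerSemicontinuous f) {d : Euc n} (h : ∀ v ∈ ranSubdiff f, inner ℝ v d = 0)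
    (x : Euc n) : f (x - d) ≤ f x := by
  by_cases hx : x ∈ effDom f
  swap
  · have : f x = ⊤ := by simpa [effDom] using hx
    rw [this]
    exact le_top
  set w := x - d with hw
  have hk : ∀ k : ℕ, (0 : ℝ) < k + 1 := fun k => by positivity
  choose p hp using fun k : ℕ => exists_mem_argmin_add_sq hc hf hlsc (hk k)
    (by simpa using hk k) w
  have hsub : ∀ k : ℕ, StrongSubgradient 0 f (p k) (-(((k : ℝ) + 1) • (p k - w))) := fun k =>
    strongSubgradient_of_mem_argmin hc hf (hp k) (((k : ℝ) + 1) / 2) fun y => by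
      rw [inner_smul_left]
      simpa using (quadratic_expand LinearMap.id ((k : ℝ) + 1) w (p k) y).le
  have hineq : ∀ k : ℕ, (f (p k)).toReal + ((k : ℝ) + 1) * ‖p k - w‖ ^ 2 ≤ (f x).toReal := by
    intro k
    have h1 := (hsub k).2 x hx
    have h2 := h _ (mem_iUnion.2 ⟨p k, (mem_subdiff_iff_zero hf).2 (hsub k)⟩)
    have e : x - p k = d - (p k - w) := by rw [hw]; abel
    rw [e, inner_sub_right, h2, inner_neg_left, inner_smul_left, real_inner_self_eq_norm_sq] at h1
    simp only [conj_trivial] at h1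
    linarith
  obtain ⟨C, hC, hlow⟩ := hc.exists_lower_bound hf hlsc hx
  have hbound : ∀ k : ℕ, ((k : ℝ) + 1) * ‖p k - w‖ ^ 2 ≤
      ((f x).toReal + C * (1 + ‖d‖)) + C * ‖p k - w‖ := by
    intro k
    have h1 := hlow (p k) (hsub k).1
    have h2 : ‖p k - x‖ ≤ ‖p k - w‖ + ‖d‖ := by
      have e : p k - x = (p k - w) - d := by rw [hw]; abel
      rw [e]
      exact norm_sub_le _ _
    have h3 := mul_le_mul_of_nonneg_left h2 hC
    linarith [hineq k]
  set A := (f x).toReal + C * (1 + ‖d‖) with hA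
  set R := 1 + (|A| + |C|) / 1 with hR
  have hPR : ∀ k, ‖p k - w‖ ≤ R := fun k => by
    refine le_of_sq_le_add_mul one_pos ((hbound k).trans' ?_)
    have : 0 ≤ (k : ℝ) * ‖p k - w‖ ^ 2 := by positivity
    linarith
  have hlim0 : Tendsto (fun k => ‖p k - w‖ ^ 2) atTop (𝓝 0) := by
    have h0 := (tendsto_const_div_atTop_nhds_zero_nat (A + C * R)).comp (tendsto_add_atTop_nat 1)
    refine squeeze_zero (fun k => by positivity) (fun k => ?_) h0
    simp only [Function.comp, Nat.cast_add, Nat.cast_one]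
    rw [le_div_iff₀ (hk k), mul_comm]
    exact (hbound k).trans (by gcongr; exact hPR k)
  have hlim : Tendsto p atTop (𝓝 w) := by
    rw [tendsto_iff_norm_sub_tendsto_zero]
    simpa using hlim0.sqrt
  rw [← hf.coe_toReal hx]
  refine le_of_tendsto_of_lsc hlsc hlim tendsto_const_nhds (Eventually.of_forall fun k => ?_)
  refine hf.le_coe_iff.2 ⟨(hsub k).1, (hineq k).trans' ?_⟩
  have : 0 ≤ ((k : ℝ) + 1) * ‖p k - w‖ ^ 2 := by positivity
  linarith

lemma ranSubdiff_subset_effDom_conj (hf : Proper f) : ranSubdiff f ⊆ effDom (conj f) := by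
  intro v hv
  obtain ⟨p, hp⟩ := mem_iUnion.1 hv
  rw [mem_subdiff_iff_zero hf] at hp
  refine mem_effDom_of_le_coe (c := inner ℝ v p - (f p).toReal) (iSup_le fun x => ?_)
  by_cases hx : x ∈ effDom f
  · rw [← hf.coe_toReal hx, ← EReal.coe_sub, EReal.coe_le_coe_iff]
    have := hp.2 x hx
    rw [inner_sub_right] at this
    linarith
  · have : f x = ⊤ := by simpa [effDom] using hx
    rw [this, EReal.sub_top]
    exact bot_le

lemma inner_le_zero_of_mem_effDom_conj (hf : Proper f) {d : Euc n} (hd : ∀ x, f (x + d) ≤ f x)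
    {u : Euc n} (hu : u ∈ effDom (conj f)) : inner ℝ u d ≤ 0 := by
  obtain ⟨x, hx⟩ := hf.2
  have hle : ∀ k : ℕ, inner ℝ u x + k * inner ℝ u d - (f x).toReal ≤ (conj f u).toReal := by
    intro k
    have h0 : ∀ y ∈ effDom f, ((inner ℝ u y - (f y).toReal : ℝ) : EReal) ≤ conj f u := by
      intro y hy
      rw [EReal.coe_sub, hf.coe_toReal hy]
      exact le_iSup (fun y => ((inner ℝ u y : ℝ) : EReal) - f y) y
    have hbot : conj f u ≠ ⊥ := ne_of_gt (lt_of_lt_of_le (EReal.bot_lt_coe _) (h0 x hx))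
    have h1 := (hf.le_iff hx).1 (le_add_nsmul hd k x)
    have h2 := h0 _ h1.1
    rw [← EReal.coe_toReal (ne_of_lt hu) hbot, EReal.coe_le_coe_iff, inner_add_right,
      ← Nat.cast_smul_eq_nsmul ℝ, inner_smul_right] at h2
    have := h1.2
    rw [← Nat.cast_smul_eq_nsmul ℝ] at this
    linarith
  by_contra! hpos
  obtain ⟨k, hk⟩ := exists_nat_gt (((conj f u).toReal - inner ℝ u x + (f x).toReal) / inner ℝ u d)
  rw [div_lt_iff₀ hpos] at hk
  linarith [hle k]

lemma kerRecessionConstant_of_conj (hc : AlphaConvex 0 f) (hf : Proper f)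
    (hlsc : LowerSemicontinuous f)
    (h : 0 ∈ intrinsicInterior ℝ (effDom (conj f) - Set.range (mulE Mᵀ))) :
    KerRecessionConstant M f := by
  intro d hMd hd
  refine sub_le_of_inner_subdiff_eq_zero hc hf hlsc fun v hv => ?_
  refine inner_eq_zero_of_mem_intrinsicInterior h (inner_zero_left _) ?_
    (v := v) ⟨v, ranSubdiff_subset_effDom_conj hf hv, 0, ⟨0, map_zero _⟩, sub_zero v⟩
  rintro _ ⟨u, hu, _, ⟨y, rfl⟩, rfl⟩
  simp only [inner_sub_left, inner_mulE_transpose, hMd, inner_zero_right, sub_zero]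
  exact inner_le_zero_of_mem_effDom_conj hf hd hu

lemma kerRecessionConstant_of_ranSubdiff (hc : AlphaConvex 0 f) (hf : Proper f)
    (hlsc : LowerSemicontinuous f)
    (h : (intrinsicInterior ℝ (ranSubdiff f) ∩ Set.range (mulE Mᵀ)).Nonempty) :
    KerRecessionConstant M f := by
  intro d hMd hd
  obtain ⟨_, hu, y, rfl⟩ := h
  refine sub_le_of_inner_subdiff_eq_zero hc hf hlsc fun v hv => ?_
  refine inner_eq_zero_of_mem_intrinsicInterior hu ?_
    (fun v hv => inner_le_zero_of_subdiff hf hd hv) hv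
  rw [inner_mulE_transpose, hMd, inner_zero_right]

lemma Proper.recFun_le_zero_iff (hf : Proper f) {d : Euc n} :
    recFun f d ≤ 0 ↔ ∀ x, f (x + d) ≤ f x := by
  have key : ∀ x ∈ effDom f, f (x + d) - f x ≤ 0 ↔ f (x + d) ≤ f x := by
    intro x hx
    rw [← hf.coe_toReal hx, EReal.sub_le_iff_le_add (by simp) (by simp), zero_add]
  constructor
  · intro h x
    by_cases hx : x ∈ effDom f
    · exact (key x hx).1
        ((le_iSup₂ (f := fun x (_ : x ∈ effDom f) => f (x + d) - f x) x hx).trans h)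
    · have : f x = ⊤ := by simpa [effDom] using hx
      rw [this]
      exact le_top
  · intro h
    exact iSup₂_le fun x hx => (key x hx).2 (h x)

lemma kerRecessionConstant_of_recFun (hf : Proper f)
    (h : ∀ x ∈ {x | mulE M x = 0} \ {x | -recFun f (-x) = recFun f x ∧ recFun f x = 0},
      0 < recFun f x) : KerRecessionConstant M f := by
  intro d hMd hd x
  by_contra hx
  have h1 := hf.recFun_le_zero_iff.2 hd
  refine absurd h1 (not_le.2 (h d ⟨hMd, fun h2 => hx ?_⟩))
  have h3 : recFun f (-d) = 0 := by
    have := h2.1.trans h2.2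
    rwa [EReal.neg_eq_zero_iff] at this
  simpa [sub_eq_add_neg] using hf.recFun_le_zero_iff.1 h3.le x

lemma kerRecessionConstant_of_coercive (hf : Proper f) (h : Coercive f) :
    KerRecessionConstant M f := by
  intro d _ hd
  suffices d = 0 by simp [this]
  by_contra hd0
  obtain ⟨x, hx⟩ := hf.2
  have hlim : Tendsto (fun k : ℕ => x + k • d) atTop (comap (fun x : Euc n => ‖x‖) atTop) := by
    rw [tendsto_comap_iff]
    have h1 : Tendsto (fun k : ℕ => (k : ℝ) * ‖d‖ - ‖x‖) atTop atTop :=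
      tendsto_atTop_add_const_right _ _
        (tendsto_natCast_atTop_atTop.atTop_mul_const (norm_pos_iff.2 hd0))
    refine tendsto_atTop_mono (fun k => ?_) h1
    have h2 := norm_sub_norm_le (k • d) (-x)
    rw [sub_neg_eq_add, norm_neg, add_comm (k • d) x, ← Nat.cast_smul_eq_nsmul ℝ, norm_smul,
      Real.norm_natCast] at h2
    simpa [← Nat.cast_smul_eq_nsmul ℝ] using h2
  obtain ⟨k, hk⟩ := ((h.comp hlim).eventually (lt_mem_nhds hx)).exists
  exact absurd (le_add_nsmul hd k x) (not_le.2 hk)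

lemma kerRecessionConstant_of_pos {α : ℝ} (hα : 0 < α) (hc : AlphaConvex α f) (hf : Proper f)
    (hlsc : LowerSemicontinuous f) : KerRecessionConstant M f := by
  intro d _ hd
  suffices d = 0 by simp [this]
  by_contra hd0
  obtain ⟨x, hx⟩ := hf.2
  obtain ⟨C, hC, hlow⟩ := hc.exists_lower_bound hf hlsc hx
  have hle : ∀ k : ℕ, k * ‖d‖ ≤ 1 + (|(f x).toReal + C| + |C|) / (α / 2) := by
    intro k
    have h1 := (hf.le_iff hx).1 (le_add_nsmul hd k x)
    have h2 := hlow _ h1.1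
    rw [add_sub_cancel_left, ← Nat.cast_smul_eq_nsmul ℝ, norm_smul, Real.norm_natCast] at h2
    have h3 := h1.2
    rw [← Nat.cast_smul_eq_nsmul ℝ] at h3
    exact le_of_sq_le_add_mul (by positivity) (by linarith)
  obtain ⟨k, hk⟩ := exists_nat_gt ((1 + (|(f x).toReal + C| + |C|) / (α / 2)) / ‖d‖)
  rw [div_lt_iff₀ (norm_pos_iff.2 hd0)] at hk
  exact absurd (hle k) (not_le.2 hk)

lemma kerRecessionConstant_of_isUnit (h : IsUnit (Mᵀ * M)) : KerRecessionConstant M f := by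
  intro d hMd _ x
  have : d = 0 := mulE_injective h (by rw [hMd, map_zero])
  simp [this]

end Conditions

/-! ### Critical points, saddle points and solutions -/

section Critical

variable {m n : ℕ} {M : Matrix (Fin m) (Fin n) ℝ} {f : Euc n → EReal} {g : Euc m → EReal}
  {α β : ℝ}

lemma isCritical_iff (hf : Proper f) (hfc : AlphaConvex α f) (hg : Proper g)
    (hgc : AlphaConvex β g) (hα : 0 ≤ α) {x : Euc n} {z y : Euc m} :
    IsCritical M f g x z y ↔
      StrongSubgradient α f x (-(mulE Mᵀ y)) ∧ StrongSubgradient β g z y ∧ mulE M x = z := by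
  rw [IsCritical, mem_subdiff_iff hα hfc hf, mem_frechetSubdiff_iff hgc hg, sub_eq_zero]

/-- The curvature condition makes `α ‖·‖ ^ 2 + β ‖M ·‖ ^ 2` a nonnegative quadratic form. -/
lemma curvature_nonneg (hα : 0 ≤ α) (hαβ : 0 ≤ α + β * ‖M‖ ^ 2) (d : Euc n) :
    0 ≤ α * ‖d‖ ^ 2 + β * ‖mulE M d‖ ^ 2 := by
  rcases le_total 0 β with hβ | hβ
  · positivity
  · have h1 := pow_le_pow_left₀ (norm_nonneg _) (norm_mulE_le M d) 2
    rw [mul_pow] at h1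
    have h2 := mul_le_mul_of_nonpos_left h1 hβ
    have h3 : 0 ≤ (α + β * ‖M‖ ^ 2) * ‖d‖ ^ 2 := by positivity
    linarith

lemma mem_effDom_of_add_lt_top (hf : Proper f) (hg : Proper g) {x : Euc n} {z : Euc m}
    (h : f x + g z < ⊤) : x ∈ effDom f ∧ z ∈ effDom g := by
  constructor
  · refine (lt_top_iff_ne_top (a := f x)).2 fun hx => ?_
    rw [hx, EReal.top_add_of_ne_bot (hg.1 z)] at h
    exact lt_irrefl _ h
  · refine (lt_top_iff_ne_top (a := g z)).2 fun hz => ?_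
    rw [hz, EReal.add_top_of_ne_bot (hf.1 x)] at h
    exact lt_irrefl _ h

lemma IsSolution.of_strongSubgradient (hf : Proper f) (hg : Proper g) (hα : 0 ≤ α)
    (hαβ : 0 ≤ α + β * ‖M‖ ^ 2) {x : Euc n} {z y : Euc m}
    (hx : StrongSubgradient α f x (-(mulE Mᵀ y))) (hz : StrongSubgradient β g z y)
    (hxz : mulE M x = z) : IsSolution M f g x z := by
  have hval : f x + g z = (((f x).toReal + (g z).toReal : ℝ) : EReal) := by
    rw [EReal.coe_add, hf.coe_toReal hx.1, hg.coe_toReal hz.1]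
  refine ⟨hxz, by rw [hval]; exact EReal.coe_lt_top _, ?_⟩
  rintro x' z' rfl
  rcases lt_or_eq_of_le (le_top (a := f x' + g (mulE M x'))) with h | h
  swap
  · rw [h]
    exact le_top
  obtain ⟨hx', hz'⟩ := mem_effDom_of_add_lt_top hf hg h
  rw [hval, ← hf.coe_toReal hx', ← hg.coe_toReal hz', ← EReal.coe_add, EReal.coe_le_coe_iff]
  have h1 := hx.2 x' hx'
  have h2 := hz.2 _ hz'
  have h3 := curvature_nonneg (M := M) hα hαβ (x' - x)
  rw [inner_neg_left, inner_mulE_transpose, map_sub, hxz] at h1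
  rw [map_sub, hxz] at h3
  linarith

lemma lagrangian_eq_coe (hf : Proper f) (hg : Proper g) {x : Euc n} {z : Euc m}
    (hx : x ∈ effDom f) (hz : z ∈ effDom g) (y : Euc m) : lagrangian M f g x z y =
      (((f x).toReal + (g z).toReal + inner ℝ y (mulE M x - z) : ℝ) : EReal) := by
  rw [lagrangian, EReal.coe_add, EReal.coe_add, hf.coe_toReal hx, hg.coe_toReal hz]

lemma IsSaddle.strongSubgradient (hf : Proper f) (hfc : AlphaConvex α f) (hg : Proper g)
    (hgc : AlphaConvex β g) {x : Euc n} {z y : Euc m} (h : IsSaddle M f g x z y) :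
    StrongSubgradient α f x (-(mulE Mᵀ y)) ∧ StrongSubgradient β g z y ∧ mulE M x = z := by
  obtain ⟨x₀, hx₀⟩ := hf.2
  obtain ⟨z₀, hz₀⟩ := hg.2
  have hdom : x ∈ effDom f ∧ z ∈ effDom g := by
    refine mem_effDom_of_add_lt_top hf hg
      ((lt_top_iff_ne_top (a := f x + g z)).2 fun htop => ?_)
    have h1 := (h x₀ z₀ y).2
    rw [lagrangian_eq_coe hf hg hx₀ hz₀, lagrangian, htop, EReal.top_add_coe] at h1
    exact absurd h1 (not_le.2 (EReal.coe_lt_top _))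
  obtain ⟨hx, hz⟩ := hdom
  -- moving `y` by the residual would increase the Lagrangian by the square of its norm
  have hxz : mulE M x = z := by
    have h1 := (h x z (y + (mulE M x - z))).1
    rw [lagrangian_eq_coe hf hg hx hz, lagrangian_eq_coe hf hg hx hz, EReal.coe_le_coe_iff,
      inner_add_left, real_inner_self_eq_norm_sq] at h1
    refine sub_eq_zero.1 (norm_eq_zero.1 ?_)
    nlinarith [norm_nonneg (mulE M x - z)]
  have key : ∀ x' ∈ effDom f, ∀ z' ∈ effDom g,
      (f x).toReal + (g z).toReal ≤ (f x').toReal + (g z').toReal + inner ℝ y (mulE M x' - z') := by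
    intro x' hx' z' hz'
    have h1 := (h x' z' y).2
    rw [lagrangian_eq_coe hf hg hx hz, lagrangian_eq_coe hf hg hx' hz', EReal.coe_le_coe_iff, hxz,
      sub_self, inner_zero_right, add_zero] at h1
    exact h1
  refine ⟨strongSubgradient_of_quadratic hfc hf hx 0 fun x' hx' => ?_,
    strongSubgradient_of_quadratic hgc hg hz 0 fun z' hz' => ?_, hxz⟩
  · have h1 := key x' hx' z hz
    rw [inner_neg_left, inner_mulE_transpose, map_sub, hxz]
    linarith
  · have h1 := key x hx z' hz'
    rw [hxz, ← neg_sub z' z, inner_neg_right] at h1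
    linarith

lemma norm_convex_comb_sq {V : Type*} [NormedAddCommGroup V] [InnerProductSpace ℝ V] (u v : V)
    (t : ℝ) : ‖(1 - t) • u + t • v‖ ^ 2 =
      (1 - t) * ‖u‖ ^ 2 + t * ‖v‖ ^ 2 - t * (1 - t) * ‖u - v‖ ^ 2 := by
  rw [norm_add_sq_real, norm_sub_sq_real, norm_smul, norm_smul, mul_pow, mul_pow,
    inner_smul_left, inner_smul_right, Real.norm_eq_abs, Real.norm_eq_abs, sq_abs, sq_abs]
  simp only [conj_trivial]
  ring

/-- A quadratic whose negative part is compensated by the curvature of `h` can be added to `h`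
without loss of convexity. -/
lemma convexOn_toReal_add_sq {p : ℕ} {h : Euc p → EReal} {κ τ : ℝ} {q : ℕ} (hh : Proper h)
    (hc : AlphaConvex κ h) (T : Euc p →ₗ[ℝ] Euc q)
    (hT : ∀ d, 0 ≤ κ * ‖d‖ ^ 2 + τ * ‖T d‖ ^ 2) :
    ConvexOn ℝ (effDom h) fun x => (h x).toReal + τ / 2 * ‖T x‖ ^ 2 := by
  have key : ∀ x ∈ effDom h, ∀ y ∈ effDom h, ∀ t : ℝ, 0 ≤ t → t ≤ 1 →
      (1 - t) • x + t • y ∈ effDom h ∧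
      (h ((1 - t) • x + t • y)).toReal + τ / 2 * ‖T ((1 - t) • x + t • y)‖ ^ 2 ≤
        (1 - t) * ((h x).toReal + τ / 2 * ‖T x‖ ^ 2) + t * ((h y).toReal + τ / 2 * ‖T y‖ ^ 2) := by
    intro x hx y hy t h0 h1
    obtain ⟨h2, h3⟩ := hc.toReal_le hh hx hy h0 h1
    refine ⟨h2, ?_⟩
    have h4 := mul_nonneg (mul_nonneg h0 (sub_nonneg.2 h1)) (hT (x - y))
    rw [map_add, map_smul, map_smul, norm_convex_comb_sq]
    rw [map_sub] at h4
    linarith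
  constructor
  · intro x hx y hy a b ha hb hab
    obtain rfl : a = 1 - b := by linarith
    exact (key x hx y hy b hb (by linarith)).1
  · intro x hx y hy a b ha hb hab
    obtain rfl : a = 1 - b := by linarith
    exact (key x hx y hy b hb (by linarith)).2

/-- Under the qualification condition a solution has a multiplier. The quadratic `β / 2 ‖·‖ ^ 2` is
moved from `g` to `f` along the constraint, which makes both terms convex. -/
lemma IsSolution.exists_strongSubgradient (hf : Proper f) (hfc : AlphaConvex α f) (hg : Proper g)
    (hgc : AlphaConvex β g) (hα : 0 ≤ α) (hαβ : 0 ≤ α + β * ‖M‖ ^ 2) {x : Euc n} {z : Euc m}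
    (h : IsSolution M f g x z)
    (hri : 0 ∈ intrinsicInterior ℝ (effDom g - mulE M '' effDom f)) :
    ∃ y, StrongSubgradient α f x (-(mulE Mᵀ y)) ∧ StrongSubgradient β g z y ∧ mulE M x = z := by
  obtain ⟨hxz, hlt, hmin⟩ := h
  obtain ⟨hx, hz⟩ := mem_effDom_of_add_lt_top hf hg hlt
  have h1 := (convexOn_toReal_add_sq hf hfc (mulE M) (curvature_nonneg hα hαβ)).comp_linearMap
    (LinearMap.fst ℝ (Euc n) (Euc m))
  have h2 := (convexOn_toReal_add_sq (τ := -β) hg hgc LinearMap.id (by simp)).comp_linearMap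
    (LinearMap.snd ℝ (Euc n) (Euc m))
  set D : Set (Euc n × Euc m) := effDom f ×ˢ effDom g with hD
  have hDc : Convex ℝ D := h1.1.inter h2.1
  have hconv : ConvexOn ℝ D fun p => ((f p.1).toReal + β / 2 * ‖mulE M p.1‖ ^ 2) +
      ((g p.2).toReal + -β / 2 * ‖p.2‖ ^ 2) :=
    (h1.subset (fun _ hp => hp.1) hDc).add (h2.subset (fun _ hp => hp.2) hDc)
  set A : Euc n × Euc m →ₗ[ℝ] Euc m :=
    LinearMap.snd ℝ (Euc n) (Euc m) - mulE M ∘ₗ LinearMap.fst ℝ (Euc n) (Euc m) with hA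
  have himage : A '' D = effDom g - mulE M '' effDom f := by
    ext w
    constructor
    · rintro ⟨p, hp, rfl⟩
      exact ⟨p.2, hp.2, _, ⟨p.1, hp.1, rfl⟩, rfl⟩
    · rintro ⟨b, hb, _, ⟨a, ha, rfl⟩, rfl⟩
      exact ⟨(a, b), ⟨ha, hb⟩, rfl⟩
  obtain ⟨ξ, hξ⟩ := exists_multiplier hconv A (x₀ := (x, z)) ⟨hx, hz⟩ (by simp [hA, hxz]) (by
    rintro ⟨a, b⟩ ⟨ha, hb⟩ hab
    have hab : mulE M a = b := by
      have h3 : b - mulE M a = 0 := hab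
      exact (sub_eq_zero.1 h3).symm
    have ha : a ∈ effDom f := ha
    have hb : b ∈ effDom g := hb
    have h4 := hmin a b hab
    rw [← hf.coe_toReal hx, ← hf.coe_toReal ha, ← hg.coe_toReal hz, ← hg.coe_toReal hb,
      ← EReal.coe_add, ← EReal.coe_add, EReal.coe_le_coe_iff] at h4
    simp only [hxz, hab]
    linarith) (by rwa [himage])
  have hξ' : ∀ a ∈ effDom f, ∀ b ∈ effDom g,
      (f x).toReal + β / 2 * ‖z‖ ^ 2 + ((g z).toReal - β / 2 * ‖z‖ ^ 2) +
        inner ℝ ξ (b - mulE M a) ≤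
      (f a).toReal + β / 2 * ‖mulE M a‖ ^ 2 + ((g b).toReal - β / 2 * ‖b‖ ^ 2) := by
    intro a ha b hb
    have h3 := hξ (a, b) ⟨ha, hb⟩
    have e : A (a, b) = b - mulE M a := rfl
    simp only [hxz, e] at h3
    linarith
  -- `ξ` belongs to the shifted problem; undoing the shift adds the gradient `β • z`
  refine ⟨ξ + β • z, ?_, ?_, hxz⟩
  · refine strongSubgradient_of_quadratic hfc hf hx (|β| / 2 * ‖M‖ ^ 2) fun a ha => ?_
    have h3 := hξ' a ha z hz
    have e : mulE M a = z + mulE M (a - x) := by rw [map_sub, hxz]; abel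
    rw [e, norm_add_sq_real, sub_add_cancel_left, inner_neg_right] at h3
    rw [inner_neg_left, inner_mulE_transpose, inner_add_left, inner_smul_left]
    simp only [conj_trivial]
    have h5 := pow_le_pow_left₀ (norm_nonneg _) (norm_mulE_le M (a - x)) 2
    rw [mul_pow] at h5
    have h6 : β * ‖mulE M (a - x)‖ ^ 2 ≤ |β| * ‖mulE M (a - x)‖ ^ 2 :=
      mul_le_mul_of_nonneg_right (le_abs_self β) (sq_nonneg _)
    have h7 := mul_le_mul_of_nonneg_left h5 (abs_nonneg β)
    linarith
  · refine strongSubgradient_of_quadratic hgc hg hz (|β| / 2) fun b hb => ?_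
    have h3 := hξ' x hx b hb
    have e : ‖b‖ ^ 2 = ‖z‖ ^ 2 + 2 * inner ℝ z (b - z) + ‖b - z‖ ^ 2 := by
      rw [← norm_add_sq_real, add_sub_cancel]
    rw [hxz, e] at h3
    rw [inner_add_left, inner_smul_left]
    simp only [conj_trivial]
    have h6 : -|β| * ‖b - z‖ ^ 2 ≤ β * ‖b - z‖ ^ 2 :=
      mul_le_mul_of_nonneg_right (neg_abs_le β) (sq_nonneg _)
    linarith

end Critical

/-! ### The steps of the algorithm -/

section Steps

variable {m n : ℕ} {M : Matrix (Fin m) (Fin n) ℝ} {f : Euc n → EReal} {g : Euc m → EReal}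
  {α β γ δ : ℝ}

lemma strongSubgradient_of_xStep (hfc : AlphaConvex α f) (hf : Proper f) (hγ : 0 < γ) {x : Euc n}
    {z y : Euc m} (hx : x ∈ argmin fun x' : Euc n =>
      f x' + ((γ / 2 * ‖mulE M x' - z + γ⁻¹ • y‖ ^ 2 : ℝ) : EReal)) :
    StrongSubgradient α f x (-(mulE Mᵀ (y + γ • (mulE M x - z)))) := by
  refine strongSubgradient_of_mem_argmin hfc hf hx (γ / 2 * ‖M‖ ^ 2) fun x' => ?_
  have h1 := quadratic_expand (mulE M) γ (z - γ⁻¹ • y) x x'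
  have h2 := pow_le_pow_left₀ (norm_nonneg _) (norm_mulE_le M (x' - x)) 2
  have h3 : y + γ • (mulE M x - z) = γ • (mulE M x - z + γ⁻¹ • y) := by
    rw [smul_add, smul_smul, mul_inv_cancel₀ hγ.ne', one_smul, add_comm]
  simp only [← sub_add] at h1
  rw [h1, inner_mulE_transpose, h3, inner_smul_left]
  simp only [conj_trivial]
  have h4 : γ / 2 * ‖mulE M (x' - x)‖ ^ 2 ≤ γ / 2 * (‖M‖ * ‖x' - x‖) ^ 2 := by gcongr
  linarith

lemma norm_sub_add_smul_eq (a z' y : Euc m) (δ : ℝ) :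
    ‖a - z' + δ⁻¹ • y‖ = ‖z' - (a + δ⁻¹ • y)‖ := by
  rw [← norm_neg]
  congr 1
  abel

lemma strongSubgradient_of_zStep (hgc : AlphaConvex β g) (hg : Proper g) (hδ : 0 < δ)
    {a z y : Euc m} (hz : z ∈ argmin fun z' : Euc m =>
      g z' + ((δ / 2 * ‖a - z' + δ⁻¹ • y‖ ^ 2 : ℝ) : EReal)) :
    StrongSubgradient β g z (y + δ • (a - z)) := by
  simp only [norm_sub_add_smul_eq] at hz
  have h := strongSubgradient_of_mem_argmin hgc hg hz (v := δ • (z - (a + δ⁻¹ • y))) (δ / 2)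
    fun z' => by
      rw [inner_smul_left]
      simpa using (quadratic_expand LinearMap.id δ (a + δ⁻¹ • y) z z').le
  have e : -(δ • (z - (a + δ⁻¹ • y))) = y + δ • (a - z) := by
    rw [← sub_sub, smul_sub, smul_smul, mul_inv_cancel₀ hδ.ne', one_smul, smul_sub, smul_sub]
    abel
  rwa [e] at h

lemma exists_isGenerated (hfc : AlphaConvex 0 f) (hf : Proper f) (hflsc : LowerSemicontinuous f)
    (hgc : AlphaConvex β g) (hg : Proper g) (hglsc : LowerSemicontinuous g)
    (hK : KerRecessionConstant M f) (hγ : 0 < γ) (hδ : 0 < δ) (hδβ : 0 < δ + β)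
    (x₀ : Euc n) (z₀ y₀ : Euc m) :
    ∃ (x : ℕ → Euc n) (z y : ℕ → Euc m),
      x 0 = x₀ ∧ z 0 = z₀ ∧ y 0 = y₀ ∧ IsGenerated M f g γ δ x z y := by
  choose X hX using fun z y : Euc m =>
    hK.exists_mem_argmin hfc hf hflsc hγ (z - γ⁻¹ • y)
  choose Z hZ using fun a y : Euc m =>
    exists_mem_argmin_add_sq hgc hg hglsc hδ hδβ (a + δ⁻¹ • y)
  let step : Euc n × Euc m × Euc m → Euc n × Euc m × Euc m := fun p =>
    let x := X p.2.1 p.2.2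
    let z := Z (mulE M x) p.2.2
    (x, z, p.2.2 + δ • (mulE M x - z))
  let s : ℕ → Euc n × Euc m × Euc m := fun k => Nat.rec (x₀, z₀, y₀) (fun _ p => step p) k
  refine ⟨fun k => (s k).1, fun k => (s k).2.1, fun k => (s k).2.2, rfl, rfl, rfl, fun k => ?_⟩
  refine ⟨?_, ?_, rfl⟩
  · have h := hX (s k).2.1 (s k).2.2
    simp only [← sub_add] at h
    exact h
  · have h := hZ (mulE M (s (k + 1)).1) (s k).2.2
    simp only [← norm_sub_add_smul_eq] at h
    exact h

/-- Passage to the limit in the inequalities that define strong subgradients. -/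
lemma StrongSubgradient.of_tendsto (hf : Proper f) (hlsc : LowerSemicontinuous f)
    {x u : ℕ → Euc n} {x₀ u₀ : Euc n} (h : ∀ k, StrongSubgradient α f (x k) (u k))
    (hx : Tendsto x atTop (𝓝 x₀)) (hu : Tendsto u atTop (𝓝 u₀)) :
    StrongSubgradient α f x₀ u₀ := by
  have key : ∀ y ∈ effDom f,
      f x₀ ≤ (((f y).toReal - inner ℝ u₀ (y - x₀) - α / 2 * ‖y - x₀‖ ^ 2 : ℝ) : EReal) := by
    intro y hy
    have hyx : Tendsto (fun k => y - x k) atTop (𝓝 (y - x₀)) := tendsto_const_nhds.sub hx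
    refine le_of_tendsto_of_lsc hlsc hx
      ((tendsto_const_nhds.sub (hu.inner hyx)).sub ((hyx.norm.pow 2).const_mul (α / 2)))
      (Eventually.of_forall fun k => hf.le_coe_iff.2 ⟨(h k).1, ?_⟩)
    have := (h k).2 y hy
    linarith
  obtain ⟨y₀, hy₀⟩ := hf.2
  refine ⟨mem_effDom_of_le_coe (key y₀ hy₀), fun y hy => ?_⟩
  have := (hf.le_coe_iff.1 (key y hy)).2
  linarith

/-- The point `z` depends in a Lipschitz continuous way on `y + δ z` when `y` is a subgradient at
`z`. -/
lemma StrongSubgradient.norm_sub_le {z y z' y' : Euc m} (h : StrongSubgradient β g z y)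
    (h' : StrongSubgradient β g z' y') :
    (δ + β) * ‖z - z'‖ ≤ ‖(y + δ • z) - (y' + δ • z')‖ := by
  have h1 := h.monotone h'
  have e : y - y' = ((y + δ • z) - (y' + δ • z')) - δ • (z - z') := by
    rw [smul_sub]
    abel
  rw [e, inner_sub_left, inner_smul_left, real_inner_self_eq_norm_sq] at h1
  simp only [conj_trivial] at h1
  have h2 := real_inner_le_norm ((y + δ • z) - (y' + δ • z')) (z - z')
  rcases (norm_nonneg (z - z')).eq_or_lt with h0 | h0
  · rw [← h0, mul_zero]
    exact norm_nonneg _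
  · refine le_of_mul_le_mul_right ?_ h0
    linarith

end Steps

/-! ### The descent estimate -/

section Descent

variable {m n : ℕ} {M : Matrix (Fin m) (Fin n) ℝ} {f : Euc n → EReal} {g : Euc m → EReal}
  {α β γ δ : ℝ}

lemma exists_mul_sq_le_of_sq_lt {V : Type*} [NormedAddCommGroup V] [InnerProductSpace ℝ V]
    {p q γ : ℝ} (hp : 0 < p) (hpq : γ ^ 2 < p * q) (hs : 0 < p + q - 2 * γ) :
    ∃ ε > 0, ∀ z a : V,
      ε * ‖z - a‖ ^ 2 ≤ p * ‖z‖ ^ 2 - 2 * γ * inner ℝ z a + q * ‖a‖ ^ 2 := by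
  -- `ε` keeps the form with the coefficients `p - ε`, `γ - ε`, `q - ε` positive semidefinite
  set ε := min (p / 2) ((p * q - γ ^ 2) / (p + q - 2 * γ)) with hε
  have hε0 : 0 < ε := lt_min (by positivity) (div_pos (by linarith) hs)
  have h1 : ε < p := (min_le_left _ _).trans_lt (by linarith)
  have h2 : ε * (p + q - 2 * γ) ≤ p * q - γ ^ 2 := (le_div_iff₀ hs).1 (min_le_right _ _)
  refine ⟨ε, hε0, fun z a => ?_⟩
  have h3 : 0 ≤ ‖(p - ε) • z - (γ - ε) • a‖ ^ 2 +
      ((p - ε) * (q - ε) - (γ - ε) ^ 2) * ‖a‖ ^ 2 := by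
    have : 0 ≤ (p - ε) * (q - ε) - (γ - ε) ^ 2 := by linarith
    positivity
  rw [norm_sub_sq_real, norm_smul, norm_smul, mul_pow, mul_pow, inner_smul_left, inner_smul_right,
    Real.norm_eq_abs, Real.norm_eq_abs, sq_abs, sq_abs] at h3
  simp only [conj_trivial] at h3
  rw [norm_sub_sq_real]
  refine sub_nonneg.1 (nonneg_of_mul_nonneg_right (a := p - ε) ?_ (by linarith))
  linarith

/-- For the admissible values of `γ` the quadratic form in the descent estimate dominates a
multiple of `‖z - a‖ ^ 2`: as a function of `γ`, its determinant is positive exactly within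
`paramRadius` of `δ + 2 * β`. -/
lemma exists_mul_sq_le (hM : 0 < ‖M‖) (hδβ : 0 < δ + 2 * β)
    (hαβ : 0 ≤ α + β * ‖M‖ ^ 2) (hγ_eq : α + β * ‖M‖ ^ 2 = 0 → γ = δ + 2 * β)
    (hγ_pos : 0 < α + β * ‖M‖ ^ 2 → γ ∈ Ioo (max 0 (δ + 2 * β - paramRadius M α β δ))
        (δ + 2 * β + paramRadius M α β δ)) :
    ∃ ε > 0, ∀ z a : Euc m, ε * ‖z - a‖ ^ 2 ≤ (δ + 2 * β) * ‖z‖ ^ 2 - 2 * γ * inner ℝ z a +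
      (2 * γ + 2 * (α / ‖M‖ ^ 2) - δ) * ‖a‖ ^ 2 := by
  have hM2 : 0 < ‖M‖ ^ 2 := by positivity
  have e : α + β * ‖M‖ ^ 2 = (α / ‖M‖ ^ 2 + β) * ‖M‖ ^ 2 := by field_simp
  rcases hαβ.eq_or_lt with h | h
  · obtain rfl := hγ_eq h.symm
    have hθ : α / ‖M‖ ^ 2 = -β := by
      rw [e] at h
      have := (mul_eq_zero.1 h.symm).resolve_right hM2.ne'
      linarith
    refine ⟨δ + 2 * β, hδβ, fun z a => le_of_eq ?_⟩
    rw [hθ, norm_sub_sq_real]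
    ring
  · obtain ⟨h1, h2⟩ := hγ_pos h
    have hθ : 0 < α / ‖M‖ ^ 2 + β := by
      rw [e] at h
      exact (pos_iff_pos_of_mul_pos h).2 hM2
    have hΔ : paramRadius M α β δ ^ 2 = 2 * (α / ‖M‖ ^ 2 + β) * (δ + 2 * β) := by
      rw [paramRadius, mul_pow, Real.sq_sqrt (by positivity)]
      field_simp
    have h3 : (γ - (δ + 2 * β)) ^ 2 < paramRadius M α β δ ^ 2 := by
      have := (le_max_right _ _).trans_lt h1
      exact sq_lt_sq' (by linarith) (by linarith)
    rw [hΔ] at h3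
    exact exists_mul_sq_le_of_sq_lt hδβ (by nlinarith) (by linarith)

/-- One iteration brings `s = y + δ z` closer to its value at any critical point. The next value of
`s` is `s + δ (M x - z)`. -/
lemma descent_step (hα : 0 ≤ α) (hδ : 0 < δ) (hM : 0 < ‖M‖) {xs : Euc n} {zs ys : Euc m}
    (hxs : StrongSubgradient α f xs (-(mulE Mᵀ ys))) (hzs : StrongSubgradient β g zs ys)
    (hs : mulE M xs = zs) {x : Euc n} {z y : Euc m} (hz : StrongSubgradient β g z y)
    (hx : StrongSubgradient α f x (-(mulE Mᵀ (y + γ • (mulE M x - z))))) {ε : ℝ}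
    (hε : ∀ z a : Euc m, ε * ‖z - a‖ ^ 2 ≤ (δ + 2 * β) * ‖z‖ ^ 2 - 2 * γ * inner ℝ z a +
      (2 * γ + 2 * (α / ‖M‖ ^ 2) - δ) * ‖a‖ ^ 2) :
    ‖(y + δ • z + δ • (mulE M x - z)) - (ys + δ • zs)‖ ^ 2 + δ * ε * ‖z - mulE M x‖ ^ 2 ≤
      ‖(y + δ • z) - (ys + δ • zs)‖ ^ 2 := by
  have h1 := hx.monotone hxs
  have h2 := hz.monotone hzs
  have e1 : -(mulE Mᵀ (y + γ • (mulE M x - z))) - -(mulE Mᵀ ys) =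
      -(mulE Mᵀ ((y - ys) + γ • ((mulE M x - zs) - (z - zs)))) := by
    rw [neg_sub_neg, ← map_sub, ← map_neg]
    congr 1
    rw [sub_sub_sub_cancel_right]
    abel
  rw [e1, inner_neg_left, inner_mulE_transpose, map_sub, hs] at h1
  have h3 : α / ‖M‖ ^ 2 * ‖mulE M x - zs‖ ^ 2 ≤ α * ‖x - xs‖ ^ 2 := by
    have h := pow_le_pow_left₀ (norm_nonneg _) (norm_mulE_le M (x - xs)) 2
    rw [map_sub, hs, mul_pow] at h
    calc α / ‖M‖ ^ 2 * ‖mulE M x - zs‖ ^ 2 ≤ α / ‖M‖ ^ 2 * (‖M‖ ^ 2 * ‖x - xs‖ ^ 2) := by gcongr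
      _ = α * ‖x - xs‖ ^ 2 := by field_simp
  have e2 : (y + δ • z + δ • (mulE M x - z)) - (ys + δ • zs) =
      (y - ys) + δ • (mulE M x - zs) := by module
  have e3 : (y + δ • z) - (ys + δ • zs) = (y - ys) + δ • (z - zs) := by module
  have e4 : z - mulE M x = (z - zs) - (mulE M x - zs) := by abel
  rw [e2, e3, e4]
  generalize y - ys = Y at *
  generalize z - zs = Z at *
  generalize mulE M x - zs = A at *
  have h4 := mul_le_mul_of_nonneg_left (hε Z A) hδ.le
  rw [inner_add_left, inner_smul_left, inner_sub_left, real_inner_self_eq_norm_sq] at h1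
  simp only [conj_trivial] at h1
  have h5 : inner ℝ Y A ≤ γ * inner ℝ Z A - (γ + α / ‖M‖ ^ 2) * ‖A‖ ^ 2 := by linarith
  have h6 := mul_le_mul_of_nonneg_left h5 hδ.le
  have h7 := mul_le_mul_of_nonneg_left h2 hδ.le
  rw [norm_add_sq_real, norm_add_sq_real, norm_smul, norm_smul, mul_pow, mul_pow,
    Real.norm_of_nonneg hδ.le, inner_smul_right, inner_smul_right]
  linarith

end Descent

/-! ### Convergence -/

section Convergence

variable {m n : ℕ} {M : Matrix (Fin m) (Fin n) ℝ} {f : Euc n → EReal} {g : Euc m → EReal}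
  {α β γ δ : ℝ}

/-- If the images `M (x k)` and the multipliers `u k` converge and `-Mᵀ (u k)` is a subgradient of
`f` at `x k`, then the limit of the multipliers gives a subgradient at some point over the limit
of the images, although `x k` may be unbounded: its projection along the constancy space is
bounded. -/
lemma exists_limit_strongSubgradient (hfc : AlphaConvex 0 f) (hf : Proper f)
    (hflsc : LowerSemicontinuous f) (hK : KerRecessionConstant M f) {x : ℕ → Euc n}
    {u : ℕ → Euc m} {z₀ u₀ : Euc m}
    (hx : ∀ k, StrongSubgradient 0 f (x k) (-(mulE Mᵀ (u k))))
    (hMx : Tendsto (fun k => mulE M (x k)) atTop (𝓝 z₀)) (hu : Tendsto u atTop (𝓝 u₀)) :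
    ∃ x₀, StrongSubgradient 0 f x₀ (-(mulE Mᵀ u₀)) ∧ mulE M x₀ = z₀ := by
  choose x' hx'L hx'f hx'M using fun k =>
    exists_mem_orthogonal_constancySpace (M := M) hfc hf (x k)
  have hx' : ∀ k, StrongSubgradient 0 f (x' k) (-(mulE Mᵀ (u k))) := by
    intro k
    refine ⟨by simpa [effDom, hx'f] using (hx k).1, fun y hy => ?_⟩
    have := (hx k).2 y hy
    rw [inner_neg_left, inner_mulE_transpose, map_sub] at this ⊢
    rw [hx'f, hx'M]
    linarith
  obtain ⟨a, ha⟩ := hf.2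
  have hlim : Tendsto (fun k => (f a).toReal + inner ℝ (u k) (mulE M a - mulE M (x k))) atTop
      (𝓝 ((f a).toReal + inner ℝ u₀ (mulE M a - z₀))) :=
    tendsto_const_nhds.add (hu.inner (tendsto_const_nhds.sub hMx))
  obtain ⟨c, hc⟩ := hlim.bddAbove_range
  obtain ⟨K, hKb⟩ := (hMx.norm.pow 2).bddAbove_range
  have hK0 : 0 ≤ K := (sq_nonneg _).trans (hKb ⟨0, rfl⟩)
  obtain ⟨x₀, -, ψ, hψ, hx₀⟩ := tendsto_subseq_of_bounded
    (isBounded_orthogonal_sublevel hfc hf hflsc hK c K) (x := x') (fun k => by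
      refine ⟨hx'L k, hf.le_coe_iff.2 ⟨(hx' k).1, ?_⟩, ?_⟩
      · have h1 := (hx' k).2 a ha
        have h2 : (f a).toReal + inner ℝ (u k) (mulE M a - mulE M (x k)) ≤ c := hc ⟨k, rfl⟩
        rw [inner_neg_left, inner_mulE_transpose, map_sub, hx'M] at h1
        linarith
      · rw [hx'M]
        have h2 : ‖mulE M (x k)‖ ^ 2 ≤ K := hKb ⟨k, rfl⟩
        nlinarith [norm_nonneg (x' k)])
  have hT : Continuous (mulE Mᵀ) := (mulE Mᵀ).continuous_of_finiteDimensional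
  refine ⟨x₀, StrongSubgradient.of_tendsto hf hflsc (fun k => hx' (ψ k)) hx₀
    ((hT.tendsto u₀).comp (hu.comp hψ.tendsto_atTop)).neg, ?_⟩
  refine tendsto_nhds_unique
    (((mulE M).continuous_of_finiteDimensional.tendsto x₀).comp hx₀) ?_
  refine (hMx.comp hψ.tendsto_atTop).congr fun k => ?_
  simp [hx'M]

/-- The convergence argument for one sequence of iterates. It starts at an index where `y k` is
already a subgradient of `g` at `z k`; the term `x k` is the point computed from `z k` and `y k`. -/
lemma tendsto_of_descent (hfc : AlphaConvex α f) (hf : Proper f) (hflsc : LowerSemicontinuous f)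
    (hg : Proper g) (hglsc : LowerSemicontinuous g) (hα : 0 ≤ α)
    (hδ : 0 < δ) (hδβ : 0 < δ + β) (hM : 0 < ‖M‖) (hK : KerRecessionConstant M f)
    {ε : ℝ} (hε0 : 0 < ε)
    (hε : ∀ z a : Euc m, ε * ‖z - a‖ ^ 2 ≤ (δ + 2 * β) * ‖z‖ ^ 2 - 2 * γ * inner ℝ z a +
      (2 * γ + 2 * (α / ‖M‖ ^ 2) - δ) * ‖a‖ ^ 2)
    (hcrit : ∃ x z y, StrongSubgradient α f x (-(mulE Mᵀ y)) ∧ StrongSubgradient β g z y ∧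
      mulE M x = z)
    {x : ℕ → Euc n} {z y : ℕ → Euc m}
    (hx : ∀ k, StrongSubgradient α f (x k) (-(mulE Mᵀ (y k + γ • (mulE M (x k) - z k)))))
    (hz : ∀ k, StrongSubgradient β g (z k) (y k))
    (hs : ∀ k, y (k + 1) + δ • z (k + 1) = y k + δ • z k + δ • (mulE M (x k) - z k)) :
    ∃ xs zs ys, StrongSubgradient α f xs (-(mulE Mᵀ ys)) ∧ StrongSubgradient β g zs ys ∧
      mulE M xs = zs ∧ Tendsto (fun k => mulE M (x k)) atTop (𝓝 zs) ∧
      Tendsto z atTop (𝓝 zs) ∧ Tendsto y atTop (𝓝 ys) ∧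
      ((0 < α ∨ IsUnit (Mᵀ * M)) → Tendsto x atTop (𝓝 xs)) := by
  have hfc0 : AlphaConvex 0 f := hfc.mono hα
  have hstep : ∀ xs zs ys, StrongSubgradient α f xs (-(mulE Mᵀ ys)) →
      StrongSubgradient β g zs ys → mulE M xs = zs → ∀ k,
      ‖(y (k + 1) + δ • z (k + 1)) - (ys + δ • zs)‖ ^ 2 + δ * ε * ‖z k - mulE M (x k)‖ ^ 2 ≤
        ‖(y k + δ • z k) - (ys + δ • zs)‖ ^ 2 := by
    intro xs zs ys hxs hzs hxz k
    rw [hs]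
    exact descent_step hα hδ hM hxs hzs hxz (hz k) (hx k) hε
  have hanti : ∀ xs zs ys, StrongSubgradient α f xs (-(mulE Mᵀ ys)) →
      StrongSubgradient β g zs ys → mulE M xs = zs →
      Antitone fun k => ‖(y k + δ • z k) - (ys + δ • zs)‖ ^ 2 := by
    intro xs zs ys hxs hzs hxz
    refine antitone_nat_of_succ_le fun k => (hstep xs zs ys hxs hzs hxz k).trans' ?_
    have : 0 ≤ δ * ε * ‖z k - mulE M (x k)‖ ^ 2 := by positivity
    linarith
  have hlimv : ∀ xs zs ys, StrongSubgradient α f xs (-(mulE Mᵀ ys)) →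
      StrongSubgradient β g zs ys → mulE M xs = zs →
      ∃ L, Tendsto (fun k => ‖(y k + δ • z k) - (ys + δ • zs)‖ ^ 2) atTop (𝓝 L) :=
    fun xs zs ys hxs hzs hxz => ⟨_, tendsto_atTop_ciInf (hanti xs zs ys hxs hzs hxz)
      ⟨0, by rintro _ ⟨k, rfl⟩; positivity⟩⟩
  obtain ⟨x₁, z₁, y₁, hx₁, hz₁, hxz₁⟩ := hcrit
  -- the gap `z - M x` vanishes
  have hgap : Tendsto (fun k => z k - mulE M (x k)) atTop (𝓝 0) := by
    obtain ⟨L, hL⟩ := hlimv x₁ z₁ y₁ hx₁ hz₁ hxz₁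
    have h1 := (hL.sub (hL.comp (tendsto_add_atTop_nat 1))).div_const (δ * ε)
    rw [sub_self, zero_div] at h1
    have h2 : Tendsto (fun k => ‖z k - mulE M (x k)‖ ^ 2) atTop (𝓝 0) := by
      refine squeeze_zero (fun k => by positivity) (fun k => ?_) h1
      rw [le_div_iff₀ (by positivity)]
      have := hstep x₁ z₁ y₁ hx₁ hz₁ hxz₁ k
      simp only [Function.comp]
      linarith
    rw [tendsto_zero_iff_norm_tendsto_zero]
    simpa using h2.sqrt
  -- a cluster point of the sequence
  have hsb : ∀ k, ‖(y k + δ • z k) - (y₁ + δ • z₁)‖ ≤ ‖(y 0 + δ • z 0) - (y₁ + δ • z₁)‖ :=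
    fun k => (pow_le_pow_iff_left₀ (norm_nonneg _) (norm_nonneg _) two_ne_zero).1
      (hanti x₁ z₁ y₁ hx₁ hz₁ hxz₁ (Nat.zero_le k))
  set R := ‖(y 0 + δ • z 0) - (y₁ + δ • z₁)‖ with hR
  obtain ⟨p, -, φ, hφ, hp⟩ := tendsto_subseq_of_bounded
    (s := Metric.closedBall z₁ (R / (δ + β)) ×ˢ Metric.closedBall (y₁ + δ • z₁) R)
    (Metric.isBounded_closedBall.prod Metric.isBounded_closedBall)
    (x := fun k => (z k, y k + δ • z k)) (fun k => by
      refine ⟨?_, ?_⟩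
      · rw [mem_closedBall_iff_norm, le_div_iff₀' hδβ]
        exact ((hz k).norm_sub_le hz₁).trans (hsb k)
      · rw [mem_closedBall_iff_norm]
        exact hsb k)
  obtain ⟨zs, ss⟩ := p
  have hzφ : Tendsto (fun k => z (φ k)) atTop (𝓝 zs) := (continuous_fst.tendsto _).comp hp
  have hsφ : Tendsto (fun k => y (φ k) + δ • z (φ k)) atTop (𝓝 ss) :=
    (continuous_snd.tendsto _).comp hp
  obtain ⟨ys, rfl⟩ : ∃ ys, ss = ys + δ • zs := ⟨ss - δ • zs, by abel⟩
  have hyφ : Tendsto (fun k => y (φ k)) atTop (𝓝 ys) := by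
    have := hsφ.sub (hzφ.const_smul δ)
    simpa using this
  have hgφ := hgap.comp hφ.tendsto_atTop
  have hMφ : Tendsto (fun k => mulE M (x (φ k))) atTop (𝓝 zs) := by
    have := hzφ.sub hgφ
    simpa using this
  have huφ : Tendsto (fun k => y (φ k) + γ • (mulE M (x (φ k)) - z (φ k))) atTop (𝓝 ys) := by
    have := hyφ.add ((hMφ.sub hzφ).const_smul γ)
    simpa using this
  -- the cluster point is critical
  have hzs : StrongSubgradient β g zs ys :=
    StrongSubgradient.of_tendsto hg hglsc (fun k => hz (φ k)) hzφ hyφ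
  have hx0 : ∀ k, StrongSubgradient 0 f (x (φ k))
      (-(mulE Mᵀ (y (φ k) + γ • (mulE M (x (φ k)) - z (φ k))))) := fun k => by
    rw [← mem_subdiff_iff_zero hf, mem_subdiff_iff hα hfc hf]
    exact hx (φ k)
  obtain ⟨xs, hxs, hxz⟩ := exists_limit_strongSubgradient hfc0 hf hflsc hK hx0 hMφ huφ
  rw [← mem_subdiff_iff_zero hf, mem_subdiff_iff hα hfc hf] at hxs
  -- the descent estimate at the cluster point gives convergence of the whole sequence
  have hsn : Tendsto (fun k => ‖(y k + δ • z k) - (ys + δ • zs)‖) atTop (𝓝 0) := by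
    obtain ⟨L, hL⟩ := hlimv xs zs ys hxs hzs hxz
    have h1 : Tendsto (fun k => ‖(y (φ k) + δ • z (φ k)) - (ys + δ • zs)‖ ^ 2) atTop (𝓝 0) := by
      have := ((hsφ.sub_const (ys + δ • zs)).norm).pow 2
      simpa using this
    obtain rfl := tendsto_nhds_unique (hL.comp hφ.tendsto_atTop) h1
    simpa using hL.sqrt
  have hzlim : Tendsto z atTop (𝓝 zs) := by
    rw [tendsto_iff_norm_sub_tendsto_zero]
    have h1 := hsn.div_const (δ + β)
    rw [zero_div] at h1
    refine squeeze_zero (fun k => norm_nonneg _) (fun k => ?_) h1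
    rw [le_div_iff₀' hδβ]
    exact (hz k).norm_sub_le hzs
  have hylim : Tendsto y atTop (𝓝 ys) := by
    have h1 : Tendsto (fun k => y k + δ • z k) atTop (𝓝 (ys + δ • zs)) :=
      tendsto_iff_norm_sub_tendsto_zero.2 hsn
    have := h1.sub (hzlim.const_smul δ)
    simpa using this
  have hMlim : Tendsto (fun k => mulE M (x k)) atTop (𝓝 zs) := by
    have := hzlim.sub hgap
    simpa using this
  refine ⟨xs, zs, ys, hxs, hzs, hxz, hMlim, hzlim, hylim, ?_⟩
  rintro (hα0 | hU)
  · -- strong monotonicity controls `x k - xs`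
    have hin : Tendsto (fun k => -inner ℝ (y k + γ • (mulE M (x k) - z k) - ys)
        (mulE M (x k) - zs) / α) atTop (𝓝 0) := by
      have h1 := (hylim.add ((hMlim.sub hzlim).const_smul γ)).sub_const ys
      have h2 := (h1.inner (𝕜 := ℝ) (hMlim.sub_const zs)).neg.div_const α
      simpa using h2
    have h3 : Tendsto (fun k => ‖x k - xs‖ ^ 2) atTop (𝓝 0) := by
      refine squeeze_zero (fun k => by positivity) (fun k => ?_) hin
      rw [le_div_iff₀' hα0]
      have h4 := (hx k).monotone hxs
      rwa [neg_sub_neg, ← map_sub, inner_mulE_transpose, map_sub, hxz,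
        ← neg_sub (y k + γ • (mulE M (x k) - z k)) ys, inner_neg_left] at h4
    rw [tendsto_iff_norm_sub_tendsto_zero]
    simpa using h3.sqrt
  · have hemb := LinearMap.isClosedEmbedding_of_injective
      (f := mulE M) (LinearMap.ker_eq_bot.2 (mulE_injective hU))
    rw [hemb.isInducing.tendsto_nhds_iff, hxz]
    exact hMlim

end Convergence

end AADMM

theorem mainTheorem3 {m n : ℕ} (M : Matrix (Fin m) (Fin n) ℝ) (hM : M ≠ 0)
    (f : AADMM.Euc n → EReal) (g : AADMM.Euc m → EReal) (α β : ℝ)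
    (hf : AADMM.Proper f) (hflsc : LowerSemicontinuous f) (hfconv : AADMM.AlphaConvex α f)
    (hg : AADMM.Proper g) (hglsc : LowerSemicontinuous g) (hgconv : AADMM.AlphaConvex β g)
    (hα : 0 ≤ α) (hαβ : 0 ≤ α + β * ‖M‖ ^ 2)
    (hA : (∃ x z y, AADMM.IsCritical M f g x z y) ∨
      (∃ x z y, AADMM.IsSaddle M f g x z y) ∨
      ((∃ x z, AADMM.IsSolution M f g x z) ∧
        0 ∈ intrinsicInterior ℝ (AADMM.effDom g - AADMM.mulE M '' AADMM.effDom f)))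
    (hB : 0 ∈ intrinsicInterior ℝ (AADMM.effDom (AADMM.conj f) - Set.range (AADMM.mulE Mᵀ)) ∨
      (intrinsicInterior ℝ (AADMM.ranSubdiff f) ∩ Set.range (AADMM.mulE Mᵀ)).Nonempty ∨
      (∀ x ∈ {x | AADMM.mulE M x = 0} \
          {x | -AADMM.recFun f (-x) = AADMM.recFun f x ∧ AADMM.recFun f x = 0},
        0 < AADMM.recFun f x) ∨
      AADMM.Coercive f ∨
      0 < α ∨
      IsUnit (Mᵀ * M))
    (γ δ : ℝ) (hδ : max 0 (-2 * β) < δ)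
    (hγ_eq : α + β * ‖M‖ ^ 2 = 0 → γ = δ + 2 * β)
    (hγ_pos : 0 < α + β * ‖M‖ ^ 2 →
      γ ∈ Set.Ioo (max 0 (δ + 2 * β - AADMM.paramRadius M α β δ))
        (δ + 2 * β + AADMM.paramRadius M α β δ)) :
    -- from every initial point the algorithm generates a sequence
    (∀ (x₀ : AADMM.Euc n) (z₀ y₀ : AADMM.Euc m),
      ∃ (x : ℕ → AADMM.Euc n) (z y : ℕ → AADMM.Euc m),
        x 0 = x₀ ∧ z 0 = z₀ ∧ y 0 = y₀ ∧ AADMM.IsGenerated M f g γ δ x z y) ∧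
    -- and every generated sequence converges to a critical point, which solves the problem
    (∀ (x : ℕ → AADMM.Euc n) (z y : ℕ → AADMM.Euc m), AADMM.IsGenerated M f g γ δ x z y →
      ∃ (xs : AADMM.Euc n) (zs ys : AADMM.Euc m),
        AADMM.IsCritical M f g xs zs ys ∧
        AADMM.IsSolution M f g xs zs ∧
        Filter.Tendsto (fun k => AADMM.mulE M (x k)) Filter.atTop (nhds (AADMM.mulE M xs)) ∧
        Filter.Tendsto z Filter.atTop (nhds zs) ∧
        Filter.Tendsto y Filter.atTop (nhds ys) ∧
        ((0 < α ∨ IsUnit (Mᵀ * M)) → Filter.Tendsto x Filter.atTop (nhds xs))) := by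
  have hMn : 0 < ‖M‖ := norm_pos_iff.2 hM
  have hδ0 : 0 < δ := (le_max_left _ _).trans_lt hδ
  have hδ2 : 0 < δ + 2 * β := by linarith [(le_max_right 0 (-2 * β)).trans_lt hδ]
  have hδβ : 0 < δ + β := by linarith
  have hγ : 0 < γ := by
    rcases hαβ.eq_or_lt with h | h
    · rw [hγ_eq h.symm]
      exact hδ2
    · exact (le_max_left _ _).trans_lt (hγ_pos h).1
  have hfc0 : AADMM.AlphaConvex 0 f := hfconv.mono hα
  have hK : AADMM.KerRecessionConstant M f := by
    rcases hB with h | h | h | h | h | h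
    · exact AADMM.kerRecessionConstant_of_conj hfc0 hf hflsc h
    · exact AADMM.kerRecessionConstant_of_ranSubdiff hfc0 hf hflsc h
    · exact AADMM.kerRecessionConstant_of_recFun hf h
    · exact AADMM.kerRecessionConstant_of_coercive hf h
    · exact AADMM.kerRecessionConstant_of_pos h hfconv hf hflsc
    · exact AADMM.kerRecessionConstant_of_isUnit h
  have hcrit : ∃ x z y, AADMM.StrongSubgradient α f x (-(AADMM.mulE Mᵀ y)) ∧
      AADMM.StrongSubgradient β g z y ∧ AADMM.mulE M x = z := by
    rcases hA with ⟨x, z, y, h⟩ | ⟨x, z, y, h⟩ | ⟨⟨x, z, h⟩, hri⟩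
    · exact ⟨x, z, y, (AADMM.isCritical_iff hf hfconv hg hgconv hα).1 h⟩
    · exact ⟨x, z, y, h.strongSubgradient hf hfconv hg hgconv⟩
    · exact ⟨x, z, h.exists_strongSubgradient hf hfconv hg hgconv hα hαβ hri⟩
  refine ⟨AADMM.exists_isGenerated hfc0 hf hflsc hgconv hg hglsc hK hγ hδ0 hδβ, ?_⟩
  intro x z y hgen
  obtain ⟨ε, hε0, hε⟩ := AADMM.exists_mul_sq_le hMn hδ2 hαβ hγ_eq hγ_pos
  -- `y k` is a subgradient of `g` at `z k` only from `k = 1` on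
  obtain ⟨xs, zs, ys, hxs, hzs, hxz, hMlim, hzlim, hylim, hxlim⟩ :=
    AADMM.tendsto_of_descent hfconv hf hflsc hg hglsc hα hδ0 hδβ hMn hK hε0 hε hcrit
      (x := fun k => x (k + 2)) (z := fun k => z (k + 1)) (y := fun k => y (k + 1))
      (fun k => AADMM.strongSubgradient_of_xStep hfconv hf hγ (hgen (k + 1)).1)
      (fun k => by
        have h := AADMM.strongSubgradient_of_zStep hgconv hg hδ0 (hgen k).2.1
        rwa [← (hgen k).2.2] at h)
      (fun k => by
        simp only [(hgen (k + 1)).2.2]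
        module)
  refine ⟨xs, zs, ys, (AADMM.isCritical_iff hf hfconv hg hgconv hα).2 ⟨hxs, hzs, hxz⟩,
    .of_strongSubgradient hf hg hα hαβ hxs hzs hxz, ?_, ?_, ?_, fun h => ?_⟩
  · rw [hxz]
    exact (tendsto_add_atTop_iff_nat (f := fun k => AADMM.mulE M (x k)) 2).1 hMlim
  · exact (tendsto_add_atTop_iff_nat 1).1 hzlim
  · exact (tendsto_add_atTop_iff_nat 1).1 hylim
  · exact (tendsto_add_atTop_iff_nat 2).1 (hxlim h)
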